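/- Proposition. NPRR is not worst-case optimal (not even up to a log factor) for families of problem instances defined by cardinality constraints on projections, while leapfrog triejoin is optimal up to a log factor on the family below. Consider the triangle query $Q(a,b,c)=R(a,b),S(b,c),T(a,c)$ on finite relations over $\mathbb N$. For $n\in\mathbb N$ let $\mathbf K_n$ be the class of instances $(R,S,T)$ with $$|R(a,\_)|\le n^{3/8},\quad |R(\_,b)|\le n^{5/8},\quad |S(b,\_)|\le n^{5/8},\quad |S(\_,c)|\le n^{3/8},\quad |T(a,\_)|\le n,\quad |T(\_,c)|\le 1,$$ where $E(x,\_)$ and $E(\_,y)$ are the two projections of a binary relation $E(x,y)$. Let $q(n)$ be the largest size of a query result, and $M(n)$ the largest cardinality of a relation, over the instances in $\mathbf K_n$. With $[m]=\{1,\dots,m\}$, let $\mathcal A_n$ be the product instance $$R=[\lfloor n^{3/8}\rfloor]\times[\lfloor n^{5/8}\rfloor],\quad S=[\lfloor n^{5/8}\rfloor]\times[\lfloor n^{3/8}\rfloor],\quad T=[n]\times[1].$$ Leapfrog triejoin: the three variables are bound in turn, in some fixed variable ordering, by leapfrog joins of the two relations containing the variable, over relations given as sorted tries. NPRR with threshold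 $\tau\ge 0$: a value $b\in R(\_,b)$ is heavy if it appears in more than $\tau$ tuples of $R$; $D$ is the set of heavy values and $G\subseteq R$ the set of tuples whose $b$ is not heavy; the algorithm constructs $D\times T$ and filters it with hash tables on $S$ and $R$, constructs $G\bowtie S$ and filters it with a hash table on $T$, and returns the union. Running times count RAM steps; hash table operations take unit time. Both algorithms compute the query result (for every variable ordering, every $\tau\ge0$ and every instance). Moreover: 1. For every variable ordering, leapfrog triejoin runs in time $O(n\log n)$ over $\mathbf K_n$ ($n\ge2$), and in time $O(q(n)\log M(n))$, i.e. it is worst-case optimal for $(\mathbf K_n)$ up to a log factor. 2. $\mathcal A_n\in\mathbf K_n$ for all $n$. There are constants $0<c\le C$, independent of $n$ and $\tau$, such that for all $n\ge1$ and all $\tau\ge0$ the running time $t$ of NPRR on $\mathcal A_n$ with threshold $\tau$ satisfies (a) $c\,n^{1.375}\le t\le C\,n^{1.375}$ if $\tau\ge\lfloor n^{3/8}\rfloor$; (b) $c\,n^{1.625}\le t\le C\,n^{1.625}$ if $\tau<\lfloor n^{3/8}\rfloor$. In particular $t\ge c\,n^{1.375}$ for every $\tau$, and $\Theta(n^{1.375})$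 is the running time with the best choice of $\tau$. Further, if $\tau\ge\lfloor n^{3/8}\rfloor$, then NPRR takes at most $C\,n^{1.375}$ steps on every instance in $\mathbf K_n$, so its worst-case running time over $\mathbf K_n$ is then $\Theta(n^{1.375})$. 3. For every choice of thresholds $\tau\ge0$, which may depend on $n$ and on the instance, NPRR does not run in time $O(q(n)\log M(n))$ over $(\mathbf K_n)$, i.e. it is not worst-case optimal for this family, even up to a log factor. -/

import Mathlib

/-! ### Computations with a step count -/

/-- A value together with the number of elementary (RAM) steps spent on computing it. -/
structure Timed (α : Type) where
  val : α
  time : ℕ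

namespace Timed

/-- Add `t` steps to a computation. -/
def delay {α : Type} (t : ℕ) (x : Timed α) : Timed α := ⟨x.val, t + x.time⟩

instance : Monad Timed where
  pure a := ⟨a, 0⟩
  bind x f := ⟨(f x.val).val, x.time + (f x.val).time⟩

/-- A `for` loop over an array; each iteration costs one step plus the steps of its body.  The
results of the iterations are collected in order. -/
def forEach {α β : Type} : List α → (α → Timed (List β)) → Timed (List β)
  | [], _ => ⟨[], 0⟩
  | x :: xs, f =>
    let r := f x
    let rest := forEach xs f
    ⟨r.val ++ rest.val, 1 + r.time + rest.time⟩

end Timed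

/-! ### Instances of the triangle query `Q(a,b,c) = R(a,b), S(b,c), T(a,c)` -/

/-- A finite structure over the signature `R(a,b), S(b,c), T(a,c)` with universe inside `ℕ`. -/
structure TriDB where
  R : Finset (ℕ × ℕ)
  S : Finset (ℕ × ℕ)
  T : Finset (ℕ × ℕ)

/-- The projection `E(x,_)` of a binary relation. -/
def projFst (E : Finset (ℕ × ℕ)) : Finset ℕ := E.image Prod.fst

/-- The projection `E(_,y)` of a binary relation. -/
def projSnd (E : Finset (ℕ × ℕ)) : Finset ℕ := E.image Prod.snd

namespace TriDB

/-- The query result: all `(a,b,c)` with `(a,b) ∈ R`, `(b,c) ∈ S`, `(a,c) ∈ T`. -/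
def result (A : TriDB) : Finset (ℕ × ℕ × ℕ) :=
  (projFst A.R ×ˢ projSnd A.R ×ˢ projSnd A.S).filter fun t =>
    (t.1, t.2.1) ∈ A.R ∧ (t.2.1, t.2.2) ∈ A.S ∧ (t.1, t.2.2) ∈ A.T

theorem mem_result (A : TriDB) (a b c : ℕ) :
    (a, b, c) ∈ A.result ↔ (a, b) ∈ A.R ∧ (b, c) ∈ A.S ∧ (a, c) ∈ A.T := by
  simp only [result, projFst, projSnd, Finset.mem_filter, Finset.mem_product, Finset.mem_image,
    Prod.exists, exists_and_right, exists_eq_right, and_iff_right_iff_imp]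
  rintro ⟨h1, h2, -⟩
  exact ⟨⟨b, h1⟩, ⟨a, h1⟩, ⟨b, h2⟩⟩

/-- The cardinality of the largest relation of an instance. -/
def maxCard (A : TriDB) : ℕ := max A.R.card (max A.S.card A.T.card)

end TriDB

/-! ### Families defined by cardinality constraints on projections -/

/-- Bounds, growing with the parameter `n`, on the cardinalities of the six unary projections. -/
structure ProjBounds where
  Ra : ℕ → ℝ
  Rb : ℕ → ℝ
  Sb : ℕ → ℝ
  Sc : ℕ → ℝ
  Ta : ℕ → ℝ
  Tc : ℕ → ℝ
  mono : Monotone Ra ∧ Monotone Rb ∧ Monotone Sb ∧ Monotone Sc ∧ Monotone Ta ∧ Monotone Tc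

/-- The family of problem instances given by constraints on the sizes of projections. -/
def ProjBounds.family (β : ProjBounds) (n : ℕ) : Set TriDB :=
  { A | ((projFst A.R).card : ℝ) ≤ β.Ra n ∧ ((projSnd A.R).card : ℝ) ≤ β.Rb n ∧
        ((projFst A.S).card : ℝ) ≤ β.Sb n ∧ ((projSnd A.S).card : ℝ) ≤ β.Sc n ∧
        ((projFst A.T).card : ℝ) ≤ β.Ta n ∧ ((projSnd A.T).card : ℝ) ≤ β.Tc n }

theorem ProjBounds.family_mono (β : ProjBounds) : Monotone β.family := by
  intro i j hij A hA
  obtain ⟨m1, m2, m3, m4, m5, m6⟩ := β.mono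
  obtain ⟨h1, h2, h3, h4, h5, h6⟩ := hA
  exact ⟨h1.trans (m1 hij), h2.trans (m2 hij), h3.trans (m3 hij), h4.trans (m4 hij),
    h5.trans (m5 hij), h6.trans (m6 hij)⟩

theorem natCast_rpow_monotone {e : ℝ} (he : 0 ≤ e) : Monotone fun n : ℕ => (n : ℝ) ^ e :=
  fun _ _ hij => Real.rpow_le_rpow (Nat.cast_nonneg _) (Nat.cast_le.2 hij) he

/-- `|R(a,_)| ≤ n^{3/8}`, `|R(_,b)| ≤ n^{5/8}`, `|S(b,_)| ≤ n^{5/8}`, `|S(_,c)| ≤ n^{3/8}`,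
`|T(a,_)| ≤ n`, `|T(_,c)| ≤ 1`. -/
noncomputable def skewBounds : ProjBounds where
  Ra n := (n : ℝ) ^ (3 / 8 : ℝ)
  Rb n := (n : ℝ) ^ (5 / 8 : ℝ)
  Sb n := (n : ℝ) ^ (5 / 8 : ℝ)
  Sc n := (n : ℝ) ^ (3 / 8 : ℝ)
  Ta n := (n : ℝ)
  Tc _ := 1
  mono := ⟨natCast_rpow_monotone (by norm_num), natCast_rpow_monotone (by norm_num),
    natCast_rpow_monotone (by norm_num), natCast_rpow_monotone (by norm_num),
    fun _ _ h => Nat.cast_le.2 h, fun _ _ _ => le_rfl⟩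

/-- The product instance `R = [n^{3/8}] × [n^{5/8}]`, `S = [n^{5/8}] × [n^{3/8}]`,
`T = [n] × [1]`, where `[m] = {1, …, m}` and non-integral powers are rounded down. -/
noncomputable def productInstance (n : ℕ) : TriDB where
  R := Finset.Icc 1 ⌊(n : ℝ) ^ (3 / 8 : ℝ)⌋₊ ×ˢ Finset.Icc 1 ⌊(n : ℝ) ^ (5 / 8 : ℝ)⌋₊
  S := Finset.Icc 1 ⌊(n : ℝ) ^ (5 / 8 : ℝ)⌋₊ ×ˢ Finset.Icc 1 ⌊(n : ℝ) ^ (3 / 8 : ℝ)⌋₊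
  T := Finset.Icc 1 n ×ˢ Finset.Icc 1 1

/-- `q n` is the largest result size, and `M n` the largest cardinality of a relation, over the
instances in `K n`. -/
def IsExtremal (K : ℕ → Set TriDB) (q M : ℕ → ℕ) : Prop :=
  ∀ n, IsGreatest ((fun A : TriDB => A.result.card) '' K n) (q n) ∧
    IsGreatest (TriDB.maxCard '' K n) (M n)

/-- An algorithm that takes `time n A` steps on `A ∈ K n` is worst-case optimal for the family
`K`, up to a log factor: it runs in `O(q(n) log M(n))` time over `K`, where `q(n)` is the largest
result size and `M(n)` the largest relation size in `K n`. -/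
def WorstCaseOptimalUpToLog (K : ℕ → Set TriDB) (time : ℕ → TriDB → ℕ) : Prop :=
  ∃ q M : ℕ → ℕ, IsExtremal K q M ∧
    ∃ C : ℝ, ∃ n₀ : ℕ, ∀ n ≥ n₀, ∀ A ∈ K n,
      (time n A : ℝ) ≤ C * ((q n : ℝ) * Real.logb 2 (M n))

/-! ### Linear iterators

A linear iterator is a position in a sorted array of keys.  `key`, `atEnd` and `next` are constant
time; `seek` is a galloping search that starts at the current position, so it takes
`O(log N)` steps, and visiting `m` of `N` keys in order takes amortized `O(1 + log (N / m))`. -/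

/-- Binary search for the least position in `[lo, hi]` that is `hi` or holds a key `≥ x`; one step
for each array access. -/
def bsearch (keys : Array ℕ) (x lo hi : ℕ) : Timed ℕ :=
  if lo < hi then
    if keys.getD ((lo + hi) / 2) 0 < x then
      (bsearch keys x ((lo + hi) / 2 + 1) hi).delay 1
    else
      (bsearch keys x lo ((lo + hi) / 2)).delay 1
  else ⟨lo, 0⟩
termination_by hi - lo
decreasing_by all_goals omega

/-- Galloping search from position `lo`: probe at doubling distances `step`, then search the last
interval.  Returns the least position `≥ lo` that is at the end or holds a key `≥ x`. -/
def gallop (keys : Array ℕ) (x lo step : ℕ) : Timed ℕ :=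
  if lo + step < keys.size ∧ keys.getD (lo + step) 0 < x then
    (gallop keys x (lo + step + 1) (2 * step)).delay 1
  else
    (bsearch keys x lo (min (lo + step) keys.size)).delay 1
termination_by keys.size - lo
decreasing_by omega

theorem le_bsearch (keys : Array ℕ) (x lo hi : ℕ) : lo ≤ (bsearch keys x lo hi).val := by
  fun_induction bsearch keys x lo hi with
  | case1 lo hi h h' ih => simp only [Timed.delay]; omega
  | case2 lo hi h h' ih => simpa only [Timed.delay] using ih
  | case3 lo hi h => exact le_rfl

theorem le_gallop (keys : Array ℕ) (x lo step : ℕ) : lo ≤ (gallop keys x lo step).val := by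
  fun_induction gallop keys x lo step with
  | case1 lo step h ih => simp only [Timed.delay]; omega
  | case2 lo step h => exact le_bsearch keys x lo _

theorem lt_gallop (keys : Array ℕ) (x lo : ℕ) (h : lo < keys.size) (hx : keys.getD lo 0 < x) :
    lo < (gallop keys x lo 1).val := by
  rw [gallop]
  split_ifs with h'
  · have := le_gallop keys x (lo + 1 + 1) (2 * 1)
    simp only [Timed.delay]; omega
  · have hm : min (lo + 1) keys.size = lo + 1 := by omega
    have hd : (lo + (lo + 1)) / 2 = lo := by omega
    rw [hm, bsearch, if_pos (Nat.lt_succ_self lo), hd, if_pos hx]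
    exact le_bsearch keys x (lo + 1) (lo + 1)

structure Iter where
  keys : Array ℕ
  pos : ℕ

namespace Iter

/-- The key at the current position (irrelevant if the iterator is at its end). -/
def key (i : Iter) : ℕ := i.keys.getD i.pos 0

abbrev atEnd (i : Iter) : Prop := i.keys.size ≤ i.pos

def next (i : Iter) : Timed Iter := ⟨{ i with pos := i.pos + 1 }, 1⟩

/-- Move to the least key `≥ x`, or to the end if there is none. -/
def seek (i : Iter) (x : ℕ) : Timed Iter :=
  let r := gallop i.keys x i.pos 1
  ⟨{ i with pos := r.val }, r.time⟩

/-- The number of keys not yet passed. -/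
def remaining (i : Iter) : ℕ := i.keys.size - i.pos

end Iter

/-! ### Leapfrog join of two unary relations -/

/-- The state of a leapfrog join: the array `Iter[0..1]` of iterators and the index `p` of the
iterator to be moved next (indices are modulo `2`). -/
structure Leapfrog where
  iter : Fin 2 → Iter
  p : Fin 2

namespace Leapfrog

/-- The leapfrog join is at its end as soon as one of its iterators is. -/
abbrev atEnd (s : Leapfrog) : Prop := (s.iter 0).atEnd ∨ (s.iter 1).atEnd

def remaining (s : Leapfrog) : ℕ := (s.iter 0).remaining + (s.iter 1).remaining

/-- Replace the iterator `Iter[p]` by `i`. -/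
def setCur (s : Leapfrog) (i : Iter) : Leapfrog := { s with iter := Function.update s.iter s.p i }

/-- `p := p + 1 mod 2`. -/
def advance (s : Leapfrog) : Leapfrog := { s with p := s.p + 1 }

theorem remaining_setCur (s : Leapfrog) (i : Iter) :
    (s.setCur i).remaining + (s.iter s.p).remaining = s.remaining + i.remaining := by
  obtain ⟨it, p⟩ := s
  match p with
  | 0 => simp [setCur, remaining]; omega
  | 1 => simp [setCur, remaining]; omega

theorem remaining_advance (s : Leapfrog) : s.advance.remaining = s.remaining := rfl

theorem search_decreasing (s : Leapfrog) (x : ℕ) (hx : (s.iter s.p).key < x)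
    (he : ¬ ((s.iter s.p).seek x).val.atEnd) :
    (s.setCur ((s.iter s.p).seek x).val).advance.remaining < s.remaining := by
  rw [remaining_advance]
  have h := remaining_setCur s ((s.iter s.p).seek x).val
  have hle := le_gallop (s.iter s.p).keys x (s.iter s.p).pos 1
  have hlt := lt_gallop (s.iter s.p).keys x (s.iter s.p).pos
  simp only [Iter.atEnd, Iter.remaining, Iter.seek, Iter.key] at *
  have := hlt (by omega) hx
  omega

/-- leapfrog-search: `x` is the key of `Iter[p]` (the least) and `x'` the key of `Iter[p-1]` (the
largest), so `x' ≤ x` means that all iterators are at the same key.  Otherwise `Iter[p]` seeks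
`x'`.  An iteration of the loop costs one step besides its seek. -/
def search (s : Leapfrog) : Timed Leapfrog :=
  let x' := (s.iter (s.p - 1)).key
  let x := (s.iter s.p).key
  if _hx : x' ≤ x then ⟨s, 1⟩
  else
    let r := (s.iter s.p).seek x'
    if _he : r.val.atEnd then ⟨s.setCur r.val, 1 + r.time⟩
    else (search (s.setCur r.val).advance).delay (1 + r.time)
termination_by s.remaining
decreasing_by exact search_decreasing s _ (not_le.1 _hx) _he

/-- leapfrog-init on two sorted arrays: order the two iterators by their keys and search. -/
def init (A B : Array ℕ) : Timed Leapfrog :=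
  let s : Leapfrog := ⟨![⟨A, 0⟩, ⟨B, 0⟩], if A.getD 0 0 ≤ B.getD 0 0 then 0 else 1⟩
  if s.atEnd then ⟨s, 1⟩ else (search s).delay 2

/-- leapfrog-next. -/
def next (s : Leapfrog) : Timed Leapfrog :=
  let r := (s.iter s.p).next
  if r.val.atEnd then ⟨s.setCur r.val, 1 + r.time⟩
  else (search (s.setCur r.val).advance).delay (1 + r.time)

theorem remaining_search_le (s : Leapfrog) : (search s).val.remaining ≤ s.remaining := by
  fun_induction search s with
  | case1 s x' x h => exact le_rfl
  | case2 s x' x h r he =>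
    have h1 := remaining_setCur s r.val
    have h2 := le_gallop (s.iter s.p).keys x' (s.iter s.p).pos 1
    have h3 : r.val.remaining ≤ (s.iter s.p).remaining := by
      simp only [r, Iter.remaining, Iter.seek]; omega
    show (s.setCur r.val).remaining ≤ _
    omega
  | case3 s x' x h r he ih =>
    exact ih.trans (search_decreasing s x' (not_le.1 h) he).le

theorem remaining_next_lt (s : Leapfrog) (hs : ¬ s.atEnd) :
    s.next.val.remaining < s.remaining := by
  have h1 := remaining_setCur s (s.iter s.p).next.val
  have hp : ¬ (s.iter s.p).atEnd := by
    intro hc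
    apply hs
    generalize hq : s.p = q at hc
    match q with
    | 0 => exact Or.inl hc
    | 1 => exact Or.inr hc
  have h3 : (s.iter s.p).next.val.remaining < (s.iter s.p).remaining := by
    simp only [Iter.remaining, Iter.next, Iter.atEnd] at *; omega
  have h4 := remaining_search_le (s.setCur (s.iter s.p).next.val).advance
  rw [remaining_advance] at h4
  unfold next
  simp only
  split_ifs
  · show (s.setCur _).remaining < _
    omega
  · show (search _).val.remaining < _
    omega

/-- Visit all results of the leapfrog join, running `body` at each of them and collecting the
output; one step of overhead for each test of `atEnd`. -/
def forEach {β : Type} (body : Leapfrog → Timed (List β)) (s : Leapfrog) : Timed (List β) :=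
  if _h : s.atEnd then ⟨[], 1⟩
  else
    let r := body s
    let s' := s.next
    let rest := forEach body s'.val
    ⟨r.val ++ rest.val, 1 + r.time + s'.time + rest.time⟩
termination_by s.remaining
decreasing_by exact remaining_next_lt s _h

/-- One level of the triejoin: triejoin-open (one `open` step for each of the two trie iterators,
then leapfrog-init), a traversal of the level, and triejoin-up (one `up` step for each iterator).
At each result, `body` is given the position in `A`, the position in `B`, and the key. -/
def level {β : Type} (A B : Array ℕ) (body : ℕ → ℕ → ℕ → Timed (List β)) : Timed (List β) :=
  let s := init A B
  let r := forEach (fun s => body (s.iter 0).pos (s.iter 1).pos (s.iter 0).key) s.val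
  ⟨r.val, 2 + s.time + r.time + 2⟩

end Leapfrog

/-! ### Leapfrog triejoin -/

/-- A binary relation `E(x,y)` stored as a trie: the sorted array of the keys `x`, and for each of
them a pointer to the sorted array of its children `y`. -/
structure Trie where
  keys : Array ℕ
  child : Array (Array ℕ)

/-- The trie presentation of `E`. -/
def Trie.ofRel (E : Finset (ℕ × ℕ)) : Trie where
  keys := ((projFst E).sort (· ≤ ·)).toArray
  child := (((projFst E).sort (· ≤ ·)).map fun x =>
    ((projSnd (E.filter fun e => e.1 = x)).sort (· ≤ ·)).toArray).toArray

/-- The array presented below position `i` of the first level. -/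
def Trie.openAt (t : Trie) (i : ℕ) : Array ℕ := t.child.getD i #[]

/-- Leapfrog triejoin for `E(x,y), F(y,z), G(x,z)` with variable ordering `[x,y,z]`: leapfrog joins
of `E(x,_), G(x,_)`, then of `E_x(y), F(y,_)`, then of `F_y(z), G_x(z)`.  Emitting a tuple costs
one step. -/
def triejoin (E F G : Trie) : Timed (List (ℕ × ℕ × ℕ)) :=
  Leapfrog.level E.keys G.keys fun i k x =>
    Leapfrog.level (E.openAt i) F.keys fun _ j y =>
      Leapfrog.level (F.openAt j) (G.openAt k) fun _ _ z => ⟨[(x, y, z)], 1⟩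

/-- The atom of the triangle query on the distinct variables `u` and `v` (`a, b, c` are numbered
`0, 1, 2`), with `u` in the first column. -/
def TriDB.atom (A : TriDB) : Fin 3 → Fin 3 → Finset (ℕ × ℕ)
  | 0, 1 => A.R
  | 1, 0 => A.R.image Prod.swap
  | 1, 2 => A.S
  | 2, 1 => A.S.image Prod.swap
  | 0, 2 => A.T
  | 2, 0 => A.T.image Prod.swap
  | _, _ => ∅

/-- Leapfrog triejoin for the triangle query with variable ordering `[σ 0, σ 1, σ 2]`, on relations
that are provided in sorted order consistent with the variable ordering.  The emitted tuples are
written as `(a, b, c)`. -/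
def leapfrogTriejoin (σ : Equiv.Perm (Fin 3)) (A : TriDB) : Timed (List (ℕ × ℕ × ℕ)) :=
  let r := triejoin (Trie.ofRel (A.atom (σ 0) (σ 1))) (Trie.ofRel (A.atom (σ 1) (σ 2)))
    (Trie.ofRel (A.atom (σ 0) (σ 2)))
  ⟨r.val.map fun t =>
    let v : Fin 3 → ℕ := ![t.1, t.2.1, t.2.2] ∘ σ.symm
    (v 0, v 1, v 2), r.time⟩

/-! ### The NPRR algorithm on the triangle query

Hash table operations (insertion, update, lookup) cost one step each. -/

/-- Build a hash table that holds the given keys. -/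
def buildHashSet {α : Type} [DecidableEq α] (l : List α) : Timed (Finset α) :=
  ⟨l.toFinset, l.length⟩

/-- Build a hash table that maps a key `b` to the array of all `c` with `(b, c)` in the list. -/
def buildHashIndex (l : List (ℕ × ℕ)) : Timed (ℕ → List ℕ) :=
  ⟨fun b => (l.filter fun e => e.1 = b).map Prod.snd, l.length⟩

/-- Build a hash table that maps a key `b` to the number of pairs `(a, b)` in the list. -/
def buildHashCount (l : List (ℕ × ℕ)) : Timed (ℕ → ℕ) :=
  ⟨fun b => (l.filter fun e => e.2 = b).length, l.length⟩

/-- The elements of a list that pass a test costing `t` steps. -/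
def filterTimed {α : Type} (t : ℕ) (P : α → Prop) [DecidablePred P] (l : List α) :
    Timed (List α) :=
  Timed.forEach l fun x => ⟨if P x then [x] else [], t⟩

open Classical in
/-- NPRR for `R(a,b), S(b,c), T(a,c)` with heavy-key threshold `τ`.  A join key `b ∈ R(_,b)` is
heavy if it appears in more than `τ` tuples of `R`; `D` is the set of heavy join keys and `G ⊆ R`
the set of tuples without a heavy join key.  The algorithm (1) constructs `D × T` and filters it
with hash tables on `S` and `R`, (2) constructs `G ⋈ S` and filters it with a hash table on `T`,
and returns the union of the two results. -/
noncomputable def nprr (τ : ℝ) (A : TriDB) : Timed (List (ℕ × ℕ × ℕ)) := do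
  let hR ← buildHashSet A.R.toList
  let hS ← buildHashSet A.S.toList
  let hT ← buildHashSet A.T.toList
  let idxS ← buildHashIndex A.S.toList
  let cnt ← buildHashCount A.R.toList
  let D ← filterTimed 1 (fun b => τ < (cnt b : ℝ)) (projSnd A.R).toList
  let hD ← buildHashSet D
  let G ← filterTimed 1 (fun e : ℕ × ℕ => e.2 ∉ hD) A.R.toList
  let DT ← Timed.forEach D fun b =>
    Timed.forEach A.T.toList fun e => ⟨[(e.1, b, e.2)], 1⟩
  let out₁ ← filterTimed 2 (fun t : ℕ × ℕ × ℕ => (t.2.1, t.2.2) ∈ hS ∧ (t.1, t.2.1) ∈ hR) DT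
  let GS ← Timed.forEach G fun e =>
    Timed.forEach (idxS e.2) fun c => ⟨[(e.1, e.2, c)], 1⟩
  let out₂ ← filterTimed 1 (fun t : ℕ × ℕ × ℕ => (t.1, t.2.2) ∈ hT) GS
  return out₁ ++ out₂

/-! Everything rests on each variable having one small projection. In every instance of the family
`a` ranges over at most n^{3/8} values of `R`, `b` over at most n^{5/8} and `c` over a single value
of `T`, so a result has at most n^{3/8}·n^{5/8} ≤ n tuples. The product instance attains the bound
up to rounding, so q(n) lies between n/4 and n, while M(n) = n (`isExtremal_skewBounds`).

A leapfrog join alternates between its two iterators, so its number of moves is bounded by the size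
of either array, in particular of the smaller one; a potential function makes this precise
(`Leapfrog.level_time_le`). Nesting three levels gives the product of the three small projections
times a logarithm (`triejoin_time_le`). That product does not depend on the variable ordering, hence
O(n log n) for every ordering. Correctness follows from the invariant that seeking never skips a
pair of equal keys (`Leapfrog.match_seek_iff`).

NPRR lacks this adaptivity. Its running time has an exact formula (`nprr_time`), dominated by
|D|·|T| and |G ⋈ S|. In the product instance all join keys have the same degree ⌊n^{3/8}⌋, so any
threshold makes either all of them heavy, at cost about n^{5/8}·n, or none, at cost about n·n^{3/8}.
Both costs exceed n log n by a power of n. -/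

/-- The keys of an array are strictly increasing. -/
def StrictSorted (A : Array ℕ) : Prop :=
  ∀ i j, i < j → j < A.size → A.getD i 0 < A.getD j 0

theorem StrictSorted.le {A : Array ℕ} (h : StrictSorted A) {i j : ℕ} (hij : i ≤ j)
    (hj : j < A.size) : A.getD i 0 ≤ A.getD j 0 := by
  rcases hij.eq_or_lt with rfl | hlt
  · exact le_rfl
  · exact (h i j hlt hj).le

theorem StrictSorted.eq_of_getD_eq {A : Array ℕ} (h : StrictSorted A) {i j : ℕ}
    (hi : i < A.size) (hj : j < A.size) (hij : A.getD i 0 = A.getD j 0) : i = j := by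
  rcases lt_trichotomy i j with hl | he | hl
  · exact absurd (h i j hl hj) (by omega)
  · exact he
  · exact absurd (h j i hl hi) (by omega)

/-! ### Searching -/

/-- Sortedness extends each comparison at the midpoint to everything on its left. Position `hi`
itself is never inspected, so nothing is claimed about its key. -/
theorem bsearch_spec {keys : Array ℕ} (hs : StrictSorted keys) (x lo hi : ℕ) (hlo : lo ≤ hi)
    (hhi : hi ≤ keys.size) :
    (bsearch keys x lo hi).val ≤ hi ∧
      (∀ i, lo ≤ i → i < (bsearch keys x lo hi).val → keys.getD i 0 < x) ∧
      ((bsearch keys x lo hi).val < hi → x ≤ keys.getD (bsearch keys x lo hi).val 0) := by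
  fun_induction bsearch keys x lo hi with
  | case1 lo hi h h' ih =>
    obtain ⟨h1, h2, h3⟩ := ih (by omega) hhi
    refine ⟨h1, fun i hi1 hi2 => ?_, h3⟩
    by_cases hc : (lo + hi) / 2 + 1 ≤ i
    · exact h2 i hc hi2
    · exact (hs.le (by omega) (by omega : (lo + hi) / 2 < keys.size)).trans_lt h'
  | case2 lo hi h h' ih =>
    obtain ⟨h1, h2, h3⟩ := ih (by omega) (by omega)
    simp only [Timed.delay]
    refine ⟨by omega, h2, fun _ => ?_⟩
    rcases h1.eq_or_lt with he | hl
    · rw [he]; exact not_lt.1 h'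
    · exact h3 hl
  | case3 lo hi h =>
    exact ⟨hlo, fun i h1 h2 => absurd h2 (not_lt.2 h1), fun hc => absurd hc h⟩

/-- A successful probe shows that all keys up to it are below `x`; the failed probe supplies the
fact about the right end that `bsearch_spec` leaves open. -/
theorem gallop_spec {keys : Array ℕ} (hs : StrictSorted keys) (x lo step : ℕ)
    (hlo : lo ≤ keys.size) :
    (∀ i, lo ≤ i → i < (gallop keys x lo step).val → keys.getD i 0 < x) ∧
      ((gallop keys x lo step).val < keys.size →
        x ≤ keys.getD (gallop keys x lo step).val 0) := by
  fun_induction gallop keys x lo step with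
  | case1 lo step h ih =>
    obtain ⟨h2, h3⟩ := ih (by omega)
    refine ⟨fun i hi1 hi2 => ?_, h3⟩
    by_cases hc : lo + step + 1 ≤ i
    · exact h2 i hc hi2
    · exact (hs.le (by omega) h.1).trans_lt h.2
  | case2 lo step h =>
    obtain ⟨h1, h2, h3⟩ := bsearch_spec hs x lo (min (lo + step) keys.size) (by omega) (by omega)
    simp only [Timed.delay]
    refine ⟨h2, fun hlt => ?_⟩
    rcases h1.eq_or_lt with he | hl
    · have hm : min (lo + step) keys.size = lo + step := by omega
      rw [he, hm]
      exact not_lt.1 fun hc => h ⟨by omega, hc⟩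
    · exact h3 hl

/-! ### Correctness of the leapfrog join of two arrays -/

theorem Fin.two_eq_or_eq_add_one (p i : Fin 2) : i = p ∨ i = p + 1 := by
  revert p i; decide

namespace Leapfrog

theorem sub_one_eq (p : Fin 2) : p - 1 = p + 1 := by revert p; decide

theorem add_one_ne (p : Fin 2) : p + 1 ≠ p := by revert p; decide

theorem add_one_add_one (p : Fin 2) : p + 1 + 1 = p := by revert p; decide

/-- Both arrays are strictly sorted. -/
def Sorted (s : Leapfrog) : Prop := ∀ i, StrictSorted (s.iter i).keys

theorem atEnd_iff (s : Leapfrog) : s.atEnd ↔ ∃ i, (s.iter i).atEnd := by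
  simp [Fin.exists_fin_two]

/-- Splits statements about both iterators into the one that moves and the one that stays, without
cases on the value of `p`. -/
theorem forall_fin_two_iff (p : Fin 2) {P : Fin 2 → Prop} : (∀ i, P i) ↔ P p ∧ P (p + 1) := by
  refine ⟨fun h => ⟨h _, h _⟩, fun h i => ?_⟩
  rcases Fin.two_eq_or_eq_add_one p i with rfl | rfl
  · exact h.1
  · exact h.2

/-- `f` gives positions, not yet passed, of equal keys in the two arrays. -/
def Match (s : Leapfrog) (f : Fin 2 → ℕ) : Prop :=
  (∀ i, (s.iter i).pos ≤ f i ∧ f i < (s.iter i).keys.size) ∧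
    ∃ x, ∀ i, (s.iter i).keys.getD (f i) 0 = x

theorem not_match_of_atEnd {s : Leapfrog} (h : s.atEnd) (f : Fin 2 → ℕ) : ¬ s.Match f := by
  intro hf
  obtain ⟨i, hi⟩ := s.atEnd_iff.1 h
  have := hf.1 i
  simp only [Iter.atEnd] at hi
  omega

theorem setCur_iter_self (s : Leapfrog) (i : Iter) : (s.setCur i).iter s.p = i := by
  simp [setCur]

theorem setCur_iter_other (s : Leapfrog) (i : Iter) :
    (s.setCur i).iter (s.p + 1) = s.iter (s.p + 1) := by
  simp [setCur]

theorem keys_setCur (s : Leapfrog) {it : Iter} (h : it.keys = (s.iter s.p).keys) (i : Fin 2) :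
    ((s.setCur it).iter i).keys = (s.iter i).keys := by
  rcases Fin.two_eq_or_eq_add_one s.p i with rfl | rfl
  · rw [setCur_iter_self, h]
  · rw [setCur_iter_other]

theorem match_setCur_iff (s : Leapfrog) {it : Iter} (h : it.keys = (s.iter s.p).keys)
    (hp : (s.iter s.p).pos ≤ it.pos) (f : Fin 2 → ℕ) :
    (s.setCur it).Match f ↔ s.Match f ∧ it.pos ≤ f s.p := by
  simp only [Match, forall_fin_two_iff s.p, setCur_iter_self, setCur_iter_other, h]
  constructor
  · rintro ⟨⟨⟨h1, h2⟩, h3⟩, h4⟩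
    exact ⟨⟨⟨⟨hp.trans h1, h2⟩, h3⟩, h4⟩, h1⟩
  · rintro ⟨⟨⟨⟨_, h2⟩, h3⟩, h4⟩, h1⟩
    exact ⟨⟨⟨h1, h2⟩, h3⟩, h4⟩

theorem match_advance (s : Leapfrog) (f : Fin 2 → ℕ) : s.advance.Match f ↔ s.Match f := Iff.rfl

/-- A skipped position of `Iter[p]` holds a key below the current key of the other iterator, whereas
every remaining key of the other array is at least that key. So no skipped position belongs to a
match. -/
theorem match_seek_iff {s : Leapfrog} (hs : s.Sorted) (f : Fin 2 → ℕ) :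
    (s.setCur ((s.iter s.p).seek (s.iter (s.p - 1)).key).val).Match f ↔ s.Match f := by
  have hle := le_gallop (s.iter s.p).keys (s.iter (s.p - 1)).key (s.iter s.p).pos 1
  rw [match_setCur_iff s (it := ((s.iter s.p).seek (s.iter (s.p - 1)).key).val) rfl hle,
    and_iff_left_iff_imp]
  rintro ⟨h1, x, h2⟩
  by_contra hc
  have hp : (s.iter s.p).pos ≤ (s.iter s.p).keys.size := ((h1 s.p).1.trans_lt (h1 s.p).2).le
  have h3 := (gallop_spec (hs s.p) (s.iter (s.p - 1)).key (s.iter s.p).pos 1 hp).1 (f s.p)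
    (h1 s.p).1 (not_le.1 hc)
  have h4 := (hs (s.p - 1)).le (h1 (s.p - 1)).1 (h1 (s.p - 1)).2
  rw [h2] at h3 h4
  exact absurd h4 (not_le.2 h3)

/-- Restores the precondition of `search_spec` after the roles of the two iterators are exchanged.
-/
theorem key_le_key_seek {s : Leapfrog} (hs : s.Sorted) (hend : ¬ s.atEnd)
    (he : ¬ ((s.iter s.p).seek (s.iter (s.p - 1)).key).val.atEnd) :
    (s.iter (s.p - 1)).key ≤ ((s.iter s.p).seek (s.iter (s.p - 1)).key).val.key := by
  have hp : (s.iter s.p).pos ≤ (s.iter s.p).keys.size := by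
    rw [atEnd_iff, not_exists] at hend
    have := hend s.p
    simp only [Iter.atEnd] at this
    omega
  exact (gallop_spec (hs s.p) _ _ 1 hp).2 (not_le.1 he)

theorem not_atEnd_setCur {s : Leapfrog} {it : Iter} (hend : ¬ s.atEnd) (he : ¬ it.atEnd) :
    ¬ (s.setCur it).atEnd := by
  rw [atEnd_iff, not_exists, forall_fin_two_iff s.p] at hend ⊢
  rw [setCur_iter_self, setCur_iter_other]
  exact ⟨he, hend.2⟩

theorem atEnd_setCur {s : Leapfrog} {it : Iter} (he : it.atEnd) : (s.setCur it).atEnd :=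
  (atEnd_iff _).2 ⟨s.p, by rwa [setCur_iter_self]⟩

/-- leapfrog-search keeps all matches and stops at the first of them, or at the end. -/
theorem search_spec (s : Leapfrog) (hs : s.Sorted) (hend : ¬ s.atEnd)
    (hkey : (s.iter s.p).key ≤ (s.iter (s.p + 1)).key) :
    (∀ i, ((search s).val.iter i).keys = (s.iter i).keys) ∧
      (∀ f, (search s).val.Match f ↔ s.Match f) ∧
      ((search s).val.atEnd ∨ ((search s).val.iter 0).key = ((search s).val.iter 1).key) := by
  fun_induction search s with
  | case1 s x' x h =>
    refine ⟨fun _ => rfl, fun _ => Iff.rfl, Or.inr ?_⟩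
    simp only [x', x, sub_one_eq] at h
    have he : (s.iter s.p).key = (s.iter (s.p + 1)).key := le_antisymm hkey h
    have key : ∀ i, (s.iter i).key = (s.iter s.p).key :=
      (forall_fin_two_iff s.p).2 ⟨rfl, he.symm⟩
    rw [key 0, key 1]
  | case2 s x' x h r he =>
    exact ⟨keys_setCur s rfl, match_seek_iff hs, Or.inl (atEnd_setCur he)⟩
  | case3 s x' x h r he ih =>
    have hk := keys_setCur s (it := r.val) rfl
    have hs' : (s.setCur r.val).advance.Sorted := fun i => by
      show StrictSorted ((s.setCur r.val).iter i).keys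
      rw [hk]; exact hs i
    have hle := key_le_key_seek hs hend he
    obtain ⟨h1, h2, h3⟩ := ih hs' (not_atEnd_setCur hend he) (by
      show ((s.setCur r.val).iter (s.p + 1)).key ≤ ((s.setCur r.val).iter (s.p + 1 + 1)).key
      rw [setCur_iter_other, add_one_add_one, setCur_iter_self, ← sub_one_eq]
      exact hle)
    refine ⟨fun i => (h1 i).trans (hk i), fun f => (h2 f).trans ?_, h3⟩
    exact (match_advance _ f).trans (match_seek_iff hs f)

/-- Both iterators start at position 0, so initially the matches are all pairs of positions with
equal keys; the choice of `p` puts the smaller key first, as `search_spec` requires. -/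
theorem init_spec {A B : Array ℕ} (hA : StrictSorted A) (hB : StrictSorted B) :
    (∀ i, ((init A B).val.iter i).keys = ![A, B] i) ∧
      (∀ f, (init A B).val.Match f ↔
        (f 0 < A.size ∧ f 1 < B.size) ∧ A.getD (f 0) 0 = B.getD (f 1) 0) ∧
      ((init A B).val.atEnd ∨ ((init A B).val.iter 0).key = ((init A B).val.iter 1).key) := by
  set s : Leapfrog := ⟨![⟨A, 0⟩, ⟨B, 0⟩], if A.getD 0 0 ≤ B.getD 0 0 then 0 else 1⟩ with hsdef
  have hm : ∀ f, s.Match f ↔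
      (f 0 < A.size ∧ f 1 < B.size) ∧ A.getD (f 0) 0 = B.getD (f 1) 0 := by
    intro f
    simp [Match, Fin.forall_fin_two, hsdef, eq_comm]
  have hk : ∀ i, (s.iter i).keys = ![A, B] i := by simp [Fin.forall_fin_two, hsdef]
  have hinit : init A B = if s.atEnd then ⟨s, 1⟩ else (search s).delay 2 := rfl
  by_cases he : s.atEnd
  · rw [hinit, if_pos he]
    exact ⟨hk, hm, Or.inl he⟩
  · rw [hinit, if_neg he]
    have hs : s.Sorted := by simp [Sorted, Fin.forall_fin_two, hsdef, hA, hB]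
    have hkey : (s.iter s.p).key ≤ (s.iter (s.p + 1)).key := by
      by_cases hc : A.getD 0 0 ≤ B.getD 0 0
      · have hp : s.p = 0 := by rw [hsdef]; exact if_pos hc
        rw [hp]; simpa [hsdef, Iter.key] using hc
      · have hp : s.p = 1 := by rw [hsdef]; exact if_neg hc
        rw [hp]; simpa [hsdef, Iter.key] using (not_le.1 hc).le
    obtain ⟨h1, h2, h3⟩ := search_spec s hs he hkey
    exact ⟨fun i => (h1 i).trans (hk i), fun f => (h2 f).trans (hm f), h3⟩

/-- leapfrog-next drops the current match and keeps all others. -/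
theorem next_spec {s : Leapfrog} (hs : s.Sorted) (hend : ¬ s.atEnd)
    (heq : (s.iter 0).key = (s.iter 1).key) :
    (∀ i, (s.next.val.iter i).keys = (s.iter i).keys) ∧
      (∀ f, s.Match f ↔ (f = fun i => (s.iter i).pos) ∨ s.next.val.Match f) ∧
      (s.next.val.atEnd ∨ (s.next.val.iter 0).key = (s.next.val.iter 1).key) := by
  set it : Iter := (s.iter s.p).next.val with hit
  have hk := keys_setCur s (it := it) rfl
  have hpos : ∀ i, (s.iter i).pos < (s.iter i).keys.size := by
    intro i
    rw [atEnd_iff, not_exists] at hend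
    exact not_le.1 (hend i)
  have hkey : ∀ i, (s.iter i).key = (s.iter 0).key := by
    simp [Fin.forall_fin_two, heq]
  have hm : ∀ f, s.Match f ↔ (f = fun i => (s.iter i).pos) ∨ (s.setCur it).Match f := by
    intro f
    rw [match_setCur_iff s (it := it) rfl (Nat.le_succ _)]
    constructor
    · intro hf
      by_cases hc : it.pos ≤ f s.p
      · exact Or.inr ⟨hf, hc⟩
      -- A match that does not survive the move sits at the current position of `Iter[p]`. Its key
      -- is then the current common key, and strict sortedness forces the other position too.
      · left
        obtain ⟨h1, x, h2⟩ := hf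
        have hfp : f s.p = (s.iter s.p).pos :=
          le_antisymm (Nat.lt_succ_iff.1 (not_le.1 hc)) (h1 s.p).1
        have hx : x = (s.iter 0).key := by rw [← h2 s.p, hfp]; exact hkey s.p
        funext i
        exact (hs i).eq_of_getD_eq (h1 i).2 (hpos i) ((h2 i).trans (hx.trans (hkey i).symm))
    · rintro (rfl | hf)
      · exact ⟨fun i => ⟨le_rfl, hpos i⟩, _, hkey⟩
      · exact hf.1
  by_cases he : it.atEnd
  · have hn : s.next.val = s.setCur it := by
      unfold next; simp only; rw [if_pos he]
    rw [hn]
    exact ⟨hk, hm, Or.inl (atEnd_setCur he)⟩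
  · have hn : s.next.val = (search (s.setCur it).advance).val := by
      unfold next; simp only; rw [if_neg he]; rfl
    have hs' : (s.setCur it).advance.Sorted := fun i => by
      show StrictSorted ((s.setCur it).iter i).keys
      rw [hk]; exact hs i
    obtain ⟨h1, h2, h3⟩ := search_spec _ hs' (not_atEnd_setCur hend he) (by
      show ((s.setCur it).iter (s.p + 1)).key ≤ ((s.setCur it).iter (s.p + 1 + 1)).key
      rw [setCur_iter_other, add_one_add_one, setCur_iter_self, hkey, ← hkey s.p]
      exact (hs s.p _ _ (Nat.lt_succ_self _) (not_le.1 he)).le)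
    rw [hn]
    exact ⟨fun i => (h1 i).trans (hk i), fun f => (hm f).trans (or_congr_right (h2 f).symm), h3⟩

/-- By `next_spec` the matches are the current one together with those left after `next`, which is
the recursion of the loop. The body sees only positions and key, so it can be evaluated at a match
instead of at a state. -/
theorem mem_forEach {β : Type} (body : ℕ → ℕ → ℕ → Timed (List β)) (s : Leapfrog)
    (hs : s.Sorted) (h : s.atEnd ∨ (s.iter 0).key = (s.iter 1).key) (z : β) :
    z ∈ (forEach (fun s => body (s.iter 0).pos (s.iter 1).pos (s.iter 0).key) s).val ↔
      ∃ f, s.Match f ∧ z ∈ (body (f 0) (f 1) ((s.iter 0).keys.getD (f 0) 0)).val := by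
  generalize hB : (fun s : Leapfrog => body (s.iter 0).pos (s.iter 1).pos (s.iter 0).key) = B
  fun_induction forEach B s with
  | case1 s he =>
    simp only [List.not_mem_nil, false_iff, not_exists, not_and]
    exact fun f hf => absurd hf (not_match_of_atEnd he f)
  | case2 s he r s' rest ih =>
    obtain ⟨h1, h2, h3⟩ := next_spec hs he (h.resolve_left he)
    have hs' : s'.val.Sorted := fun i => by
      show StrictSorted (s.next.val.iter i).keys
      rw [h1]; exact hs i
    rw [List.mem_append, ih hs' h3]
    simp only [h2, or_and_right, exists_or, exists_eq_left, r, ← hB, s', h1]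
    rfl

theorem mem_level {β : Type} {A B : Array ℕ} (hA : StrictSorted A) (hB : StrictSorted B)
    (body : ℕ → ℕ → ℕ → Timed (List β)) (z : β) :
    z ∈ (level A B body).val ↔ ∃ i j, (i < A.size ∧ j < B.size) ∧ A.getD i 0 = B.getD j 0 ∧
      z ∈ (body i j (A.getD i 0)).val := by
  obtain ⟨h1, h2, h3⟩ := init_spec hA hB
  have hs : (init A B).val.Sorted := fun i => by
    rw [h1]; revert i; simp [Fin.forall_fin_two, hA, hB]
  refine (mem_forEach body _ hs h3 z).trans ?_
  simp only [h2, h1, Matrix.cons_val_zero]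
  constructor
  · rintro ⟨f, ⟨h4, h5⟩, h6⟩
    exact ⟨f 0, f 1, h4, h5, h6⟩
  · rintro ⟨i, j, h4, h5, h6⟩
    exact ⟨![i, j], ⟨h4, h5⟩, h6⟩

end Leapfrog

/-! ### Tries -/

theorem strictSorted_sort (s : Finset ℕ) : StrictSorted (s.sort (· ≤ ·)).toArray := by
  intro i j hij hj
  have hj' : j < (s.sort (· ≤ ·)).length := by simpa using hj
  have hi' : i < (s.sort (· ≤ ·)).length := hij.trans hj'
  have := (Finset.sortedLT_sort s).strictMono_get (a := ⟨i, hi'⟩) (b := ⟨j, hj'⟩) hij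
  have hi : i < s.card := by simpa using hi'
  have hj : j < s.card := by simpa using hj'
  simpa [Array.getD, hi, hj] using this

theorem exists_getD_sort_iff (s : Finset ℕ) (x : ℕ) :
    (∃ i < (s.sort (· ≤ ·)).toArray.size, (s.sort (· ≤ ·)).toArray.getD i 0 = x) ↔ x ∈ s := by
  rw [← Finset.mem_sort (s := s) (· ≤ ·), List.mem_iff_getElem]
  constructor
  · rintro ⟨i, hi, h⟩
    have hi' : i < s.card := by simpa using hi
    refine ⟨i, by simpa using hi, ?_⟩
    rw [← h]; simp [Array.getD, hi']
  · rintro ⟨i, hi, h⟩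
    have hi' : i < s.card := by simpa using hi
    refine ⟨i, by simpa using hi, ?_⟩
    rw [← h]; simp [Array.getD, hi']

/-- The bound on `i` matters: past the end `openAt` is empty, while the default key 0 may have a
nonempty fibre. -/
theorem Trie.openAt_ofRel (E : Finset (ℕ × ℕ)) {i : ℕ} (hi : i < (Trie.ofRel E).keys.size) :
    (Trie.ofRel E).openAt i =
      ((projSnd (E.filter fun e => e.1 = (Trie.ofRel E).keys.getD i 0)).sort (· ≤ ·)).toArray := by
  have hi' : i < (projFst E).card := by simpa [Trie.ofRel] using hi
  simp [Trie.openAt, Trie.ofRel, Array.getD, hi']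

theorem mem_projSnd_fiber (E : Finset (ℕ × ℕ)) (x y : ℕ) :
    y ∈ projSnd (E.filter fun e => e.1 = x) ↔ (x, y) ∈ E := by
  simp [projSnd]

theorem mem_projFst {E : Finset (ℕ × ℕ)} {x y : ℕ} (h : (x, y) ∈ E) : x ∈ projFst E :=
  Finset.mem_image_of_mem Prod.fst h

theorem mem_projSnd {E : Finset (ℕ × ℕ)} {x y : ℕ} (h : (x, y) ∈ E) : y ∈ projSnd E :=
  Finset.mem_image_of_mem Prod.snd h

theorem Trie.strictSorted_keys (E : Finset (ℕ × ℕ)) : StrictSorted (Trie.ofRel E).keys :=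
  strictSorted_sort _

theorem Trie.strictSorted_openAt (E : Finset (ℕ × ℕ)) {i : ℕ}
    (hi : i < (Trie.ofRel E).keys.size) : StrictSorted ((Trie.ofRel E).openAt i) := by
  rw [Trie.openAt_ofRel E hi]; exact strictSorted_sort _

theorem Trie.exists_getD_keys_iff (E : Finset (ℕ × ℕ)) (x : ℕ) :
    (∃ i < (Trie.ofRel E).keys.size, (Trie.ofRel E).keys.getD i 0 = x) ↔ x ∈ projFst E :=
  exists_getD_sort_iff (projFst E) x

theorem Trie.exists_getD_openAt_iff (E : Finset (ℕ × ℕ)) {i : ℕ}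
    (hi : i < (Trie.ofRel E).keys.size) (y : ℕ) :
    (∃ j < ((Trie.ofRel E).openAt i).size, ((Trie.ofRel E).openAt i).getD j 0 = y) ↔
      ((Trie.ofRel E).keys.getD i 0, y) ∈ E := by
  rw [Trie.openAt_ofRel E hi, exists_getD_sort_iff, mem_projSnd_fiber]

theorem mem_triejoin (E F G : Finset (ℕ × ℕ)) (x y z : ℕ) :
    (x, y, z) ∈ (triejoin (Trie.ofRel E) (Trie.ofRel F) (Trie.ofRel G)).val ↔
      (x, y) ∈ E ∧ (y, z) ∈ F ∧ (x, z) ∈ G := by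
  unfold triejoin
  rw [Leapfrog.mem_level (Trie.strictSorted_keys E) (Trie.strictSorted_keys G)]
  constructor
  · rintro ⟨i, k, ⟨hi, hk⟩, hik, h⟩
    rw [Leapfrog.mem_level (Trie.strictSorted_openAt E hi) (Trie.strictSorted_keys F)] at h
    obtain ⟨l, j, ⟨hl, hj⟩, hlj, h⟩ := h
    rw [Leapfrog.mem_level (Trie.strictSorted_openAt F hj) (Trie.strictSorted_openAt G hk)] at h
    obtain ⟨u, v, ⟨hu, hv⟩, huv, h⟩ := h
    simp only [List.mem_singleton, Prod.mk.injEq] at h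
    obtain ⟨rfl, rfl, rfl⟩ := h
    refine ⟨(Trie.exists_getD_openAt_iff E hi _).1 ⟨l, hl, rfl⟩, ?_, ?_⟩
    · rw [hlj]
      exact (Trie.exists_getD_openAt_iff F hj _).1 ⟨u, hu, rfl⟩
    · rw [hik, huv]
      exact (Trie.exists_getD_openAt_iff G hk _).1 ⟨v, hv, rfl⟩
  · rintro ⟨hE, hF, hG⟩
    obtain ⟨i, hi, rfl⟩ := (Trie.exists_getD_keys_iff E x).2 (mem_projFst hE)
    obtain ⟨k, hk, hik⟩ := (Trie.exists_getD_keys_iff G _).2 (mem_projFst hG)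
    obtain ⟨j, hj, rfl⟩ := (Trie.exists_getD_keys_iff F y).2 (mem_projFst hF)
    obtain ⟨l, hl, hlj⟩ := (Trie.exists_getD_openAt_iff E hi _).2 hE
    obtain ⟨u, hu, rfl⟩ := (Trie.exists_getD_openAt_iff F hj z).2 hF
    -- The children in `G` are found through position `k` of its own key array, so the common key is
    -- rewritten as the key stored there.
    rw [← hik] at hG
    obtain ⟨v, hv, huv⟩ := (Trie.exists_getD_openAt_iff G hk _).2 hG
    refine ⟨i, k, ⟨hi, hk⟩, hik.symm, ?_⟩
    rw [Leapfrog.mem_level (Trie.strictSorted_openAt E hi) (Trie.strictSorted_keys F)]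
    refine ⟨l, j, ⟨hl, hj⟩, hlj, ?_⟩
    rw [Leapfrog.mem_level (Trie.strictSorted_openAt F hj) (Trie.strictSorted_openAt G hk)]
    exact ⟨u, v, ⟨hu, hv⟩, huv.symm, by rw [hlj]; exact List.mem_singleton_self _⟩

/-! ### Variable orderings -/

theorem TriDB.mem_atom_swap (A : TriDB) {i j : Fin 3} (hij : i ≠ j) (x y : ℕ) :
    (x, y) ∈ A.atom i j ↔ (y, x) ∈ A.atom j i := by
  fin_cases i <;> fin_cases j <;> simp [TriDB.atom] at hij ⊢

/-- Quantifying over all ordered pairs of variables is redundant but symmetric, so permuting the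
variables becomes a reindexing. -/
theorem TriDB.mem_result_iff_atom (A : TriDB) (v : Fin 3 → ℕ) :
    (v 0, v 1, v 2) ∈ A.result ↔ ∀ i j, i ≠ j → (v i, v j) ∈ A.atom i j := by
  rw [A.mem_result]
  constructor
  · rintro ⟨hR, hS, hT⟩ i j hij
    fin_cases i <;> fin_cases j <;> simp_all [TriDB.atom]
  · intro h
    exact ⟨h 0 1 (by decide), h 1 2 (by decide), h 0 2 (by decide)⟩

theorem TriDB.mem_result_iff_perm (A : TriDB) (σ : Equiv.Perm (Fin 3)) (v : Fin 3 → ℕ) :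
    (v 0, v 1, v 2) ∈ A.result ↔ (v (σ 0), v (σ 1)) ∈ A.atom (σ 0) (σ 1) ∧
      (v (σ 1), v (σ 2)) ∈ A.atom (σ 1) (σ 2) ∧ (v (σ 0), v (σ 2)) ∈ A.atom (σ 0) (σ 2) := by
  rw [A.mem_result_iff_atom]
  have hne : ∀ {i j : Fin 3}, i ≠ j → σ i ≠ σ j := fun h => σ.injective.ne h
  constructor
  · intro h
    exact ⟨h _ _ (hne (by decide)), h _ _ (hne (by decide)), h _ _ (hne (by decide))⟩
  · rintro ⟨h1, h2, h3⟩
    have key : ∀ i j, i ≠ j → (v (σ i), v (σ j)) ∈ A.atom (σ i) (σ j) := by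
      intro i j hij
      have hswap := (A.mem_atom_swap (hne hij) (v (σ i)) (v (σ j))).2
      -- Pairs in increasing order are the hypotheses; decreasing ones follow by swapping columns.
      fin_cases i <;> fin_cases j <;> first | exact absurd rfl hij | assumption | skip
      all_goals exact hswap (by assumption)
    intro i j hij
    simpa using key (σ.symm i) (σ.symm j) (σ.symm.injective.ne hij)

theorem leapfrogTriejoin_toFinset (σ : Equiv.Perm (Fin 3)) (A : TriDB) :
    (leapfrogTriejoin σ A).val.toFinset = A.result := by
  ext ⟨a, b, c⟩
  simp only [leapfrogTriejoin, List.mem_toFinset, List.mem_map]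
  rw [show (a, b, c) = (![a, b, c] 0, ![a, b, c] 1, ![a, b, c] 2) from rfl,
    A.mem_result_iff_perm σ]
  constructor
  · rintro ⟨⟨x, y, z⟩, h, he⟩
    rw [mem_triejoin] at h
    have hv : ![a, b, c] = ![x, y, z] ∘ σ.symm := by
      simp only [Prod.mk.injEq] at he
      funext i
      fin_cases i
      · exact he.1.symm
      · exact he.2.1.symm
      · exact he.2.2.symm
    rw [hv]
    simpa using h
  · intro h
    refine ⟨(![a, b, c] (σ 0), ![a, b, c] (σ 1), ![a, b, c] (σ 2)), (mem_triejoin _ _ _ _ _ _).2 h,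
      ?_⟩
    have hv : ![![a, b, c] (σ 0), ![a, b, c] (σ 1), ![a, b, c] (σ 2)] ∘ σ.symm = ![a, b, c] := by
      have : ![![a, b, c] (σ 0), ![a, b, c] (σ 1), ![a, b, c] (σ 2)] = ![a, b, c] ∘ σ := by
        funext i; fin_cases i <;> rfl
      rw [this]; funext i; simp
    simp only [hv]

/-! ### Running time of leapfrog triejoin -/

/-- Each array access at least halves the interval. -/
theorem bsearch_time_le (keys : Array ℕ) (x lo hi k : ℕ) (hk : hi - lo < 2 ^ k) :
    (bsearch keys x lo hi).time ≤ k := by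
  fun_induction bsearch keys x lo hi generalizing k with
  | case1 lo hi h h' ih =>
    obtain _ | k := k
    · simp at hk; omega
    · have := ih k (by rw [pow_succ] at hk; omega)
      simp only [Timed.delay]; omega
  | case2 lo hi h h' ih =>
    obtain _ | k := k
    · simp at hk; omega
    · have := ih k (by rw [pow_succ] at hk; omega)
      simp only [Timed.delay]; omega
  | case3 lo hi h => exact Nat.zero_le _

/-- `l` counts the doublings still possible: `2 ^ l * step` is invariant, and a step as long as the
array must fail. The last probe costs 1 and the final binary search at most `k`. -/
theorem gallop_time_le (keys : Array ℕ) (x lo step k l : ℕ) (hk : keys.size < 2 ^ k)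
    (hl : keys.size ≤ 2 ^ l * step) : (gallop keys x lo step).time ≤ k + 1 + l := by
  fun_induction gallop keys x lo step generalizing l with
  | case1 lo step h ih =>
    obtain _ | l := l
    · simp at hl; omega
    · have := ih l (by rw [pow_succ, mul_assoc] at hl; exact hl)
      simp only [Timed.delay]; omega
  | case2 lo step h =>
    have := bsearch_time_le keys x lo (min (lo + step) keys.size) k (by omega)
    simp only [Timed.delay]; omega

theorem Iter.seek_time_le (i : Iter) (x k : ℕ) (hk : i.keys.size < 2 ^ k) :
    (i.seek x).time ≤ 2 * k + 1 := by
  have := gallop_time_le i.keys x i.pos 1 k k hk (by omega)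
  simp only [Iter.seek]; omega

/-! ### Amortized time of one leapfrog join -/

namespace Leapfrog

open Classical in
/-- A bound on the number of moves of a leapfrog join that depends on one of its two arrays only:
every other move advances the iterator `Iter[j]`. -/
noncomputable def potential (j : Fin 2) (s : Leapfrog) : ℕ :=
  2 * (s.iter j).remaining + (if s.p = j then 0 else 1) + (if s.atEnd then 0 else 1)

/-- Moving `Iter[j]` gains at least 2 from its remaining keys and loses 1 in the turn indicator;
moving the other iterator gains 1 because the turn passes to `j`. -/
theorem potential_setCur_advance_lt {j : Fin 2} {s : Leapfrog} {it : Iter} (hend : ¬ s.atEnd)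
    (he : ¬ it.atEnd) (hr : it.remaining < (s.iter s.p).remaining) :
    potential j (s.setCur it).advance + 1 ≤ potential j s := by
  have he' : ¬ (s.setCur it).advance.atEnd := not_atEnd_setCur hend he
  have hp : (s.setCur it).advance.p = s.p + 1 := rfl
  have hi : (s.setCur it).advance.iter = (s.setCur it).iter := rfl
  rw [potential, potential, if_neg hend, if_neg he', hp, hi]
  rcases Fin.two_eq_or_eq_add_one s.p j with rfl | rfl
  · rw [setCur_iter_self, if_neg (add_one_ne _), if_pos rfl]; omega
  · rw [setCur_iter_other, if_pos rfl, if_neg (add_one_ne _).symm]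

/-- The last move does not pass the turn, so it is paid for by the end indicator. -/
theorem potential_setCur_lt {j : Fin 2} {s : Leapfrog} {it : Iter} (hend : ¬ s.atEnd)
    (he : it.atEnd) : potential j (s.setCur it) + 1 ≤ potential j s := by
  have hp : (s.setCur it).p = s.p := rfl
  rw [potential, potential, if_neg hend, if_pos (atEnd_setCur he), hp]
  rcases Fin.two_eq_or_eq_add_one s.p j with rfl | rfl
  · have : it.remaining = 0 := Nat.sub_eq_zero_of_le he
    rw [setCur_iter_self]; omega
  · rw [setCur_iter_other]

/-- An iteration that moves costs at most `2 * k + 2`, a seek and one step, and lowers the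
potential; the extra 1 is the final successful comparison. -/
theorem search_time_le (j : Fin 2) (k : ℕ) (s : Leapfrog) (hend : ¬ s.atEnd)
    (hk : ∀ i, (s.iter i).keys.size < 2 ^ k) :
    (search s).time + (2 * k + 2) * potential j (search s).val
        ≤ (2 * k + 2) * potential j s + 1 ∧
      potential j (search s).val ≤ potential j s ∧
      ∀ i, ((search s).val.iter i).keys.size < 2 ^ k := by
  fun_induction search s with
  | case1 s x' x h => exact ⟨by simp only; omega, le_rfl, hk⟩
  | case2 s x' x h r he =>
    have h1 := (s.iter s.p).seek_time_le x' k (hk _)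
    have h2 := potential_setCur_lt (j := j) hend he
    have h3 := Nat.mul_le_mul_left (2 * k + 2) h2
    refine ⟨?_, (Nat.le_succ _).trans h2, fun i => by
      show ((s.setCur r.val).iter i).keys.size < _
      rw [keys_setCur s (it := r.val) rfl]; exact hk i⟩
    simp only [r] at *
    rw [mul_add] at h3
    omega
  | case3 s x' x h r he ih =>
    have h1 := (s.iter s.p).seek_time_le x' k (hk _)
    have hp : r.val.remaining < (s.iter s.p).remaining := by
      have := lt_gallop (s.iter s.p).keys x' (s.iter s.p).pos
      have hle := le_gallop (s.iter s.p).keys x' (s.iter s.p).pos 1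
      simp only [Iter.atEnd, Iter.remaining, r, Iter.seek] at *
      have := this (by omega) (not_le.1 h)
      omega
    have h2 := potential_setCur_advance_lt (j := j) hend he hp
    have h3 := Nat.mul_le_mul_left (2 * k + 2) h2
    obtain ⟨h4, h5, h6⟩ := ih (not_atEnd_setCur hend he) fun i => by
      show ((s.setCur r.val).iter i).keys.size < _
      rw [keys_setCur s (it := r.val) rfl]; exact hk i
    refine ⟨?_, h5.trans (by omega), h6⟩
    simp only [Timed.delay, r] at *
    rw [mul_add] at h3
    omega

theorem next_time_le (j : Fin 2) (k : ℕ) (s : Leapfrog) (hend : ¬ s.atEnd)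
    (hk : ∀ i, (s.iter i).keys.size < 2 ^ k) :
    s.next.time + (2 * k + 2) * potential j s.next.val ≤ (2 * k + 2) * potential j s + 1 ∧
      potential j s.next.val + 1 ≤ potential j s ∧
      ∀ i, (s.next.val.iter i).keys.size < 2 ^ k := by
  set it : Iter := (s.iter s.p).next.val with hit
  have hk' : ∀ i, ((s.setCur it).iter i).keys.size < 2 ^ k := fun i => by
    rw [keys_setCur s (it := it) rfl]; exact hk i
  by_cases he : it.atEnd
  · have hn : s.next = ⟨s.setCur it, 2⟩ := by
      unfold next; simp only; rw [if_pos he]; rfl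
    have h2 := potential_setCur_lt (j := j) hend he
    have h3 := Nat.mul_le_mul_left (2 * k + 2) h2
    rw [hn]
    refine ⟨?_, h2, hk'⟩
    rw [mul_add] at h3
    simp only
    omega
  · have hn : s.next = (search (s.setCur it).advance).delay 2 := by
      unfold next; simp only; rw [if_neg he]; rfl
    have hp : it.remaining < (s.iter s.p).remaining := by
      simp only [Iter.remaining, Iter.atEnd, it, Iter.next] at *; omega
    have h2 := potential_setCur_advance_lt (j := j) hend he hp
    have h3 := Nat.mul_le_mul_left (2 * k + 2) h2
    obtain ⟨h4, h5, h6⟩ := search_time_le j k (s.setCur it).advance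
      (not_atEnd_setCur hend he) hk'
    rw [hn]
    refine ⟨?_, (by simp only [Timed.delay]; omega), h6⟩
    rw [mul_add] at h3
    simp only [Timed.delay]
    omega

/-- Each visit lowers the potential, which pays the `W + 2` steps outside the amortized moves; the
moves telescope by `next_time_le`. -/
theorem forEach_time_le {β : Type} (j : Fin 2) (k W : ℕ) (body : Leapfrog → Timed (List β))
    (hW : ∀ s, (body s).time ≤ W) (s : Leapfrog) (hk : ∀ i, (s.iter i).keys.size < 2 ^ k) :
    (forEach body s).time ≤ (W + (2 * k + 2) + 2) * potential j s + 1 := by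
  fun_induction forEach body s with
  | case1 s he => simp only; omega
  | case2 s he r s' rest ih =>
    obtain ⟨h1, h2, h3⟩ := next_time_le j k s he hk
    have h4 := ih h3
    have h5 := hW s
    have h6 := Nat.mul_le_mul_left (W + 2) h2
    simp only [r, s', rest] at *
    nlinarith

theorem level_time_le {β : Type} {A B : Array ℕ} {k m W : ℕ}
    {body : ℕ → ℕ → ℕ → Timed (List β)} (hA : A.size < 2 ^ k) (hB : B.size < 2 ^ k)
    (hm : A.size ≤ m ∨ B.size ≤ m) (hW : ∀ i j x, (body i j x).time ≤ W) :
    (level A B body).time ≤ 10 * (m + 1) * (W + (2 * k + 2)) := by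
  obtain ⟨j, hj⟩ : ∃ j : Fin 2, (![A, B] j).size ≤ m := by
    rcases hm with h | h
    · exact ⟨0, h⟩
    · exact ⟨1, h⟩
  set s : Leapfrog := ⟨![⟨A, 0⟩, ⟨B, 0⟩], if A.getD 0 0 ≤ B.getD 0 0 then 0 else 1⟩ with hsdef
  have hinit : init A B = if s.atEnd then ⟨s, 1⟩ else (search s).delay 2 := rfl
  have hk : ∀ i, (s.iter i).keys.size < 2 ^ k := by simp [Fin.forall_fin_two, hsdef, hA, hB]
  have hpot : potential j s ≤ 2 * m + 2 := by
    have : (s.iter j).remaining = (![A, B] j).size := by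
      revert j; simp [Fin.forall_fin_two, hsdef, Iter.remaining]
    unfold potential
    split_ifs <;> omega
  obtain ⟨h1, h2, h3⟩ : (init A B).time ≤ (2 * k + 2) * potential j s + 3 ∧
      potential j (init A B).val ≤ potential j s ∧
      ∀ i, ((init A B).val.iter i).keys.size < 2 ^ k := by
    rw [hinit]
    split_ifs with he
    · exact ⟨by simp only; omega, le_rfl, hk⟩
    · obtain ⟨h1, h2, h3⟩ := search_time_le j k s he hk
      exact ⟨by simp only [Timed.delay]; omega, h2, h3⟩
  have h4 := forEach_time_le j k W
    (fun s => body (s.iter 0).pos (s.iter 1).pos (s.iter 0).key) (fun _ => hW _ _ _) _ h3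
  have h5 : (level A B body).time = 2 + (init A B).time +
    (forEach (fun s => body (s.iter 0).pos (s.iter 1).pos (s.iter 0).key)
      (init A B).val).time + 2 := rfl
  have h6 := Nat.mul_le_mul_left (W + (2 * k + 2) + 2) (h2.trans hpot)
  have h7 := Nat.mul_le_mul_left (2 * k + 2) hpot
  -- With `L = 2 * k + 2`, the total is at most `(2 * m + 2) * (W + 2 * L + 2) + 8`; since `L ≥ 2`,
  -- the constants are absorbed into `10 * (m + 1) * (W + L)`.
  rw [h5]
  nlinarith

end Leapfrog

/-! ### Time of the three nested levels -/

theorem Trie.size_keys (E : Finset (ℕ × ℕ)) : (Trie.ofRel E).keys.size = (projFst E).card := by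
  simp [Trie.ofRel]

theorem Trie.size_openAt_le (E : Finset (ℕ × ℕ)) (i : ℕ) :
    ((Trie.ofRel E).openAt i).size ≤ (projSnd E).card := by
  by_cases hi : i < (Trie.ofRel E).keys.size
  · rw [Trie.openAt_ofRel E hi]
    rw [List.size_toArray, Finset.length_sort]
    exact Finset.card_le_card (Finset.image_subset_image (Finset.filter_subset _ _))
  · have : (Trie.ofRel E).openAt i = #[] := by
      have hi' : ¬ i < (projFst E).card := by simpa [Trie.ofRel] using hi
      simp [Trie.openAt, Trie.ofRel, Array.getD, hi']
    simp [this]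

/-- Each variable is bounded by the smaller of the two projections onto it. -/
theorem triejoin_time_le {E F G : Finset (ℕ × ℕ)} {k p q r : ℕ}
    (hE₁ : (projFst E).card < 2 ^ k) (hE₂ : (projSnd E).card < 2 ^ k)
    (hF₁ : (projFst F).card < 2 ^ k) (hF₂ : (projSnd F).card < 2 ^ k)
    (hG₁ : (projFst G).card < 2 ^ k) (hG₂ : (projSnd G).card < 2 ^ k)
    (hp : (projFst E).card ≤ p ∨ (projFst G).card ≤ p)
    (hq : (projSnd E).card ≤ q ∨ (projFst F).card ≤ q)
    (hr : (projSnd F).card ≤ r ∨ (projSnd G).card ≤ r) :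
    (triejoin (Trie.ofRel E) (Trie.ofRel F) (Trie.ofRel G)).time ≤
      3000 * ((p + 1) * (q + 1) * (r + 1) * (2 * k + 2)) := by
  have hz := fun j k' (x y : ℕ) => Leapfrog.level_time_le (k := k) (m := r) (W := 1)
    (A := (Trie.ofRel F).openAt j) (B := (Trie.ofRel G).openAt k')
    (body := fun _ _ z => ⟨[(x, y, z)], 1⟩)
    ((Trie.size_openAt_le F j).trans_lt hF₂) ((Trie.size_openAt_le G k').trans_lt hG₂)
    (hr.imp (Trie.size_openAt_le F j).trans (Trie.size_openAt_le G k').trans)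
    (fun _ _ _ => le_rfl)
  have hy := fun i k' (x : ℕ) => Leapfrog.level_time_le (k := k) (m := q)
    (A := (Trie.ofRel E).openAt i) (B := (Trie.ofRel F).keys)
    (body := fun _ j y => Leapfrog.level ((Trie.ofRel F).openAt j) ((Trie.ofRel G).openAt k')
      fun _ _ z => ⟨[(x, y, z)], 1⟩)
    ((Trie.size_openAt_le E i).trans_lt hE₂) (by rwa [Trie.size_keys])
    (hq.imp (Trie.size_openAt_le E i).trans (by rw [Trie.size_keys]; exact id))
    (fun _ j y => hz j k' x y)
  have hx := Leapfrog.level_time_le (k := k) (m := p)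
    (A := (Trie.ofRel E).keys) (B := (Trie.ofRel G).keys)
    (body := fun i k x =>
      Leapfrog.level ((Trie.ofRel E).openAt i) (Trie.ofRel F).keys fun _ j y =>
        Leapfrog.level ((Trie.ofRel F).openAt j) ((Trie.ofRel G).openAt k) fun _ _ z =>
          ⟨[(x, y, z)], 1⟩)
    (by rwa [Trie.size_keys]) (by rwa [Trie.size_keys])
    (by rwa [Trie.size_keys, Trie.size_keys]) (fun i k x => hy i k x)
  refine hx.trans ?_
  generalize hL : 2 * k + 2 = L
  have hL1 : 1 ≤ L := by omega
  -- Each level multiplies by 10 after one `L` is absorbed into the level below: the constants are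
  -- 20, 210 and 2110, rounded up to 3000.
  have hz' : 10 * (r + 1) * (1 + L) ≤ 20 * ((r + 1) * L) := by
    have := Nat.mul_le_mul_left (10 * (r + 1)) hL1
    nlinarith
  have hLr : L ≤ (r + 1) * L := Nat.le_mul_of_pos_left L (Nat.succ_pos r)
  have hy' : 10 * (q + 1) * (10 * (r + 1) * (1 + L) + L) ≤ 210 * ((q + 1) * ((r + 1) * L)) := by
    have := Nat.mul_le_mul_left (10 * (q + 1))
      (show 10 * (r + 1) * (1 + L) + L ≤ 21 * ((r + 1) * L) by omega)
    linarith
  have hLq : (r + 1) * L ≤ (q + 1) * ((r + 1) * L) := Nat.le_mul_of_pos_left _ (Nat.succ_pos q)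
  have := Nat.mul_le_mul_left (10 * (p + 1)) (show
    10 * (q + 1) * (10 * (r + 1) * (1 + L) + L) + L ≤ 211 * ((q + 1) * ((r + 1) * L)) by omega)
  have h0 : 0 ≤ (p + 1) * (q + 1) * (r + 1) * L := Nat.zero_le _
  linarith

/-! ### The NPRR algorithm -/

namespace Timed

theorem val_bind {α β : Type} (x : Timed α) (f : α → Timed β) : (x >>= f).val = (f x.val).val :=
  rfl

theorem time_bind {α β : Type} (x : Timed α) (f : α → Timed β) :
    (x >>= f).time = x.time + (f x.val).time := rfl

theorem val_pure {α : Type} (a : α) : (pure a : Timed α).val = a := rfl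

theorem time_pure {α : Type} (a : α) : (pure a : Timed α).time = 0 := rfl

theorem val_forEach {α β : Type} (l : List α) (f : α → Timed (List β)) :
    (forEach l f).val = l.flatMap fun x => (f x).val := by
  induction l with
  | nil => rfl
  | cons x xs ih => simp [forEach, ih]

theorem time_forEach {α β : Type} (l : List α) (f : α → Timed (List β)) :
    (forEach l f).time = (l.map fun x => 1 + (f x).time).sum := by
  induction l with
  | nil => rfl
  | cons x xs ih => simp [forEach, ih]

theorem time_forEach_const {α β : Type} (l : List α) {f : α → Timed (List β)} {t : ℕ}
    (hf : ∀ x, (f x).time = t) : (forEach l f).time = l.length * (1 + t) := by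
  simp [time_forEach, hf]

end Timed

theorem val_filterTimed {α : Type} (t : ℕ) (P : α → Prop) [DecidablePred P] (l : List α) :
    (filterTimed t P l).val = l.filter P := by
  rw [filterTimed, Timed.val_forEach]
  induction l with
  | nil => rfl
  | cons x xs ih => by_cases h : P x <;> simp [h, ih]

theorem time_filterTimed {α : Type} (t : ℕ) (P : α → Prop) [DecidablePred P] (l : List α) :
    (filterTimed t P l).time = l.length * (1 + t) :=
  Timed.time_forEach_const l fun _ => rfl

namespace TriDB

/-- The number of tuples `(a, b)` in `R`. -/
noncomputable def degR (A : TriDB) (b : ℕ) : ℕ := (A.R.filter fun e => e.2 = b).card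

/-- The number of tuples `(b, c)` in `S`. -/
noncomputable def degS (A : TriDB) (b : ℕ) : ℕ := (A.S.filter fun e => e.1 = b).card

open Classical in
/-- The heavy join keys. -/
noncomputable def heavy (τ : ℝ) (A : TriDB) : Finset ℕ :=
  (projSnd A.R).filter fun b => τ < (A.degR b : ℝ)

open Classical in
/-- The tuples of `R` without a heavy join key. -/
noncomputable def light (τ : ℝ) (A : TriDB) : Finset (ℕ × ℕ) :=
  A.R.filter fun e => e.2 ∉ A.heavy τ

end TriDB

theorem length_filter_toList {α : Type} (s : Finset α) (P : α → Prop) [DecidablePred P] :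
    (s.toList.filter P).length = (s.filter P).card := by
  classical
  have h : (s.toList.filter P).toFinset = s.filter P := by ext; simp
  rw [← h, List.toFinset_card_of_nodup (s.nodup_toList.filter _)]

theorem sum_map_filter_toList {α : Type} (s : Finset α) (P : α → Prop) [DecidablePred P]
    (f : α → ℕ) : ((s.toList.filter P).map f).sum = ∑ x ∈ s.filter P, f x := by
  classical
  have h : (s.toList.filter P).toFinset = s.filter P := by ext; simp
  rw [← h, List.sum_toFinset _ (s.nodup_toList.filter _)]

/-- The shape in which this set appears when `nprr` is unfolded. -/
theorem TriDB.light_eq (τ : ℝ) (A : TriDB) : A.light τ =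
    A.R.filter fun e => ¬ (e.2 ∈ projSnd A.R ∧ τ < ((A.R.filter fun e' => e'.2 = e.2).card : ℝ)) := by
  ext e
  rw [TriDB.light, Finset.mem_filter, Finset.mem_filter, TriDB.heavy, Finset.mem_filter]
  rfl

theorem TriDB.heavy_eq (τ : ℝ) (A : TriDB) : A.heavy τ =
    (projSnd A.R).filter fun b => τ < ((A.R.filter fun e => e.2 = b).card : ℝ) := by
  ext e
  rw [TriDB.heavy, Finset.mem_filter, Finset.mem_filter]
  rfl

/-- The coefficient 5 is 2 for building a tuple of `D × T` and 3 for filtering it with two lookups;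
the 4 is 2 for building a tuple of `G ⋈ S` and 2 for filtering it with one lookup. The other terms
are hash tables, the computation of `D` and `G`, and outer loops. -/
theorem nprr_time (τ : ℝ) (A : TriDB) :
    (nprr τ A).time = 4 * A.R.card + 2 * A.S.card + A.T.card + 2 * (projSnd A.R).card +
      2 * (A.heavy τ).card + 5 * ((A.heavy τ).card * A.T.card) + (A.light τ).card +
      4 * ∑ e ∈ A.light τ, A.degS e.2 := by
  classical
  unfold nprr
  simp only [Timed.time_bind, Timed.time_pure, val_filterTimed, time_filterTimed, buildHashSet,
    buildHashIndex, buildHashCount, Timed.val_forEach, Timed.time_forEach, length_filter_toList,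
    Finset.length_toList, List.length_flatMap, sum_map_filter_toList]
  simp only [List.map_const', List.sum_replicate, Finset.length_toList, List.length_map,
    length_filter_toList, List.length_singleton, smul_eq_mul, Finset.sum_const, List.mem_toFinset,
    List.mem_filter, Finset.mem_toList, decide_eq_true_eq, Finset.sum_add_distrib, mul_one]
  rw [← TriDB.light_eq, ← TriDB.heavy_eq, ← Finset.sum_mul]
  simp only [TriDB.degS]
  ring

/-- Each branch checks all three atoms, and every tuple of `R` has a key that is either heavy or
not, so the union loses nothing. -/
theorem nprr_toFinset (τ : ℝ) (A : TriDB) : (nprr τ A).val.toFinset = A.result := by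
  ext ⟨a, b, c⟩
  rw [A.mem_result]
  unfold nprr
  simp only [Timed.val_bind, Timed.val_pure, val_filterTimed, buildHashSet, buildHashIndex,
    buildHashCount, Timed.val_forEach]
  simp
  have := fun h : (a, b) ∈ A.R => mem_projSnd h
  rw [← not_lt]
  tauto

/-! ### The skewed family -/

/-- `⌊n^{3/8}⌋` -/
noncomputable def floorA (n : ℕ) : ℕ := ⌊(n : ℝ) ^ (3 / 8 : ℝ)⌋₊

/-- `⌊n^{5/8}⌋` -/
noncomputable def floorB (n : ℕ) : ℕ := ⌊(n : ℝ) ^ (5 / 8 : ℝ)⌋₊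

theorem floorA_mul_floorB_le (n : ℕ) : floorA n * floorB n ≤ n := by
  have h0 : (0 : ℝ) ≤ n := Nat.cast_nonneg n
  have hA := Nat.floor_le (Real.rpow_nonneg h0 (3 / 8))
  have hB := Nat.floor_le (Real.rpow_nonneg h0 (5 / 8))
  have h := mul_le_mul hA hB (Nat.cast_nonneg _) (Real.rpow_nonneg h0 _)
  rw [← Real.rpow_add_of_nonneg h0 (by norm_num) (by norm_num),
    show (3 / 8 + 5 / 8 : ℝ) = 1 by norm_num, Real.rpow_one] at h
  exact_mod_cast h

theorem one_le_floor_rpow {n : ℕ} (hn : 1 ≤ n) {e : ℝ} (he : 0 ≤ e) :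
    1 ≤ ⌊(n : ℝ) ^ e⌋₊ :=
  (Nat.one_le_floor_iff _).2 (Real.one_le_rpow (by exact_mod_cast hn) he)

theorem one_le_floorA {n : ℕ} (hn : 1 ≤ n) : 1 ≤ floorA n := one_le_floor_rpow hn (by norm_num)

theorem one_le_floorB {n : ℕ} (hn : 1 ≤ n) : 1 ≤ floorB n := one_le_floor_rpow hn (by norm_num)

theorem floor_zero_rpow {e : ℝ} (he : e ≠ 0) : ⌊((0 : ℕ) : ℝ) ^ e⌋₊ = 0 := by
  rw [Nat.cast_zero, Real.zero_rpow he, Nat.floor_zero]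

theorem floorA_le (n : ℕ) : floorA n ≤ n := by
  obtain rfl | hn := Nat.eq_zero_or_pos n
  · exact (floor_zero_rpow (by norm_num)).le
  · exact (Nat.le_mul_of_pos_right _ (one_le_floorB hn)).trans (floorA_mul_floorB_le n)

theorem floorB_le (n : ℕ) : floorB n ≤ n := by
  obtain rfl | hn := Nat.eq_zero_or_pos n
  · exact (floor_zero_rpow (by norm_num)).le
  · exact (Nat.le_mul_of_pos_left _ (one_le_floorA hn)).trans (floorA_mul_floorB_le n)

theorem half_le_floor {x : ℝ} (hx : 1 ≤ x) : x / 2 ≤ ⌊x⌋₊ := by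
  have h1 := Nat.lt_floor_add_one x
  have h2 : (1 : ℝ) ≤ ⌊x⌋₊ := by exact_mod_cast (Nat.one_le_floor_iff x).2 hx
  linarith

/-- All powers of `n` in the statement are integral powers of `n^{1/8}`. -/
theorem exists_eighth_root {n : ℕ} (hn : 1 ≤ n) : ∃ x : ℝ, 1 ≤ x ∧ (n : ℝ) = x ^ 8 ∧
    (n : ℝ) ^ (1.375 : ℝ) = x ^ 11 ∧ (n : ℝ) ^ (1.625 : ℝ) = x ^ 13 ∧
    x ^ 3 / 2 ≤ (floorA n : ℝ) ∧ (floorA n : ℝ) ≤ x ^ 3 ∧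
    x ^ 5 / 2 ≤ (floorB n : ℝ) ∧ (floorB n : ℝ) ≤ x ^ 5 := by
  have h0 : (0 : ℝ) ≤ n := Nat.cast_nonneg n
  have h1 : (1 : ℝ) ≤ n := by exact_mod_cast hn
  have hpow : ∀ (k : ℕ) (e : ℝ), (1 / 8 : ℝ) * k = e →
      (n : ℝ) ^ e = ((n : ℝ) ^ (1 / 8 : ℝ)) ^ k := fun k e he => by
    rw [← he, Real.rpow_mul h0, Real.rpow_natCast]
  have h3 := hpow 3 (3 / 8) (by norm_num)
  have h5 := hpow 5 (5 / 8) (by norm_num)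
  have hx := Real.one_le_rpow h1 (show (0 : ℝ) ≤ 1 / 8 by norm_num)
  refine ⟨(n : ℝ) ^ (1 / 8 : ℝ), hx, ?_, hpow 11 _ (by norm_num), hpow 13 _ (by norm_num), ?_, ?_,
    ?_, ?_⟩
  · rw [← hpow 8 1 (by norm_num), Real.rpow_one]
  · rw [floorA, h3]; exact half_le_floor (one_le_pow₀ hx)
  · rw [← h3]; exact Nat.floor_le (Real.rpow_nonneg h0 _)
  · rw [floorB, h5]; exact half_le_floor (one_le_pow₀ hx)
  · rw [← h5]; exact Nat.floor_le (Real.rpow_nonneg h0 _)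

/-- Rounding down costs a factor of at most 2 in each power. This converts a bound in n into a bound
in q(n). -/
theorem le_four_mul_floor {n : ℕ} (hn : 1 ≤ n) : (n : ℝ) ≤ 4 * (floorA n * floorB n : ℕ) := by
  obtain ⟨x, hx, h8, -, -, hA, -, hB, -⟩ := exists_eighth_root hn
  have h := mul_le_mul hA hB (by positivity) (Nat.cast_nonneg _)
  push_cast
  rw [h8]
  linarith [show x ^ 3 / 2 * (x ^ 5 / 2) = x ^ 8 / 4 by ring]

/-! ### Extremal result and relation sizes -/

theorem mem_skewBounds_family {n : ℕ} {A : TriDB} : A ∈ skewBounds.family n ↔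
    (projFst A.R).card ≤ floorA n ∧ (projSnd A.R).card ≤ floorB n ∧
      (projFst A.S).card ≤ floorB n ∧ (projSnd A.S).card ≤ floorA n ∧
      (projFst A.T).card ≤ n ∧ (projSnd A.T).card ≤ 1 := by
  have h0 : (0 : ℝ) ≤ n := Nat.cast_nonneg n
  simp only [ProjBounds.family, skewBounds, Set.mem_ofPred_eq, floorA, floorB,
    Nat.le_floor_iff (Real.rpow_nonneg h0 _), Nat.cast_le, Nat.cast_le_one]

theorem card_le_card_proj (E : Finset (ℕ × ℕ)) : E.card ≤ (projFst E).card * (projSnd E).card := by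
  rw [← Finset.card_product]
  exact Finset.card_le_card fun e he => Finset.mem_product.2 ⟨mem_projFst he, mem_projSnd he⟩

theorem projFst_product_subset (s t : Finset ℕ) : projFst (s ×ˢ t) ⊆ s :=
  Finset.image_subset_iff.2 fun _ h => (Finset.mem_product.1 h).1

theorem projSnd_product_subset (s t : Finset ℕ) : projSnd (s ×ˢ t) ⊆ t :=
  Finset.image_subset_iff.2 fun _ h => (Finset.mem_product.1 h).2

theorem productInstance_mem (n : ℕ) : productInstance n ∈ skewBounds.family n := by
  have h1 := fun k l => Finset.card_le_card
    (projFst_product_subset (Finset.Icc 1 k) (Finset.Icc 1 l))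
  have h2 := fun k l => Finset.card_le_card
    (projSnd_product_subset (Finset.Icc 1 k) (Finset.Icc 1 l))
  simp only [Nat.card_Icc, add_tsub_cancel_right] at h1 h2
  exact mem_skewBounds_family.2 ⟨h1 _ _, h2 _ _, h1 _ _, h2 _ _, h1 _ _, h2 _ _⟩

/-- `T` leaves at most one value for `c`, so the pairs `(a, b)` count the result. -/
theorem card_result_le {n : ℕ} {A : TriDB} (hA : A ∈ skewBounds.family n) :
    A.result.card ≤ floorA n * floorB n := by
  obtain ⟨h1, h2, -, -, -, h6⟩ := mem_skewBounds_family.1 hA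
  calc A.result.card ≤ (projFst A.R ×ˢ projSnd A.R ×ˢ projSnd A.T).card := by
        refine Finset.card_le_card fun ⟨a, b, c⟩ h => ?_
        obtain ⟨hR, -, hT⟩ := (A.mem_result a b c).1 h
        simp only [Finset.mem_product]
        exact ⟨mem_projFst hR, mem_projSnd hR, mem_projSnd hT⟩
    _ = (projFst A.R).card * ((projSnd A.R).card * (projSnd A.T).card) := by
        rw [Finset.card_product, Finset.card_product]
    _ ≤ floorA n * (floorB n * 1) := Nat.mul_le_mul h1 (Nat.mul_le_mul h2 h6)
    _ = floorA n * floorB n := by rw [mul_one]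

theorem card_rel_le {n : ℕ} {A : TriDB} (hA : A ∈ skewBounds.family n) :
    A.R.card ≤ n ∧ A.S.card ≤ n ∧ A.T.card ≤ n := by
  obtain ⟨h1, h2, h3, h4, h5, h6⟩ := mem_skewBounds_family.1 hA
  refine ⟨?_, ?_, ?_⟩
  · exact (card_le_card_proj _).trans ((Nat.mul_le_mul h1 h2).trans (floorA_mul_floorB_le n))
  · refine (card_le_card_proj _).trans ((Nat.mul_le_mul h3 h4).trans ?_)
    rw [mul_comm]; exact floorA_mul_floorB_le n
  · exact (card_le_card_proj _).trans ((Nat.mul_le_mul h5 h6).trans (mul_one n).le)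

theorem productInstance_R (n : ℕ) : (productInstance n).R =
    Finset.Icc 1 (floorA n) ×ˢ Finset.Icc 1 (floorB n) := rfl

theorem productInstance_S (n : ℕ) : (productInstance n).S =
    Finset.Icc 1 (floorB n) ×ˢ Finset.Icc 1 (floorA n) := rfl

theorem productInstance_T (n : ℕ) : (productInstance n).T =
    Finset.Icc 1 n ×ˢ Finset.Icc 1 1 := rfl

theorem card_productInstance_R (n : ℕ) : (productInstance n).R.card = floorA n * floorB n := by
  simp [productInstance_R]

theorem card_productInstance_T (n : ℕ) : (productInstance n).T.card = n := by
  simp [productInstance_T]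

theorem le_card_result_productInstance (n : ℕ) :
    floorA n * floorB n ≤ (productInstance n).result.card := by
  have h : Finset.Icc 1 (floorA n) ×ˢ Finset.Icc 1 (floorB n) ×ˢ {1} ⊆
      (productInstance n).result := by
    rintro ⟨a, b, c⟩ h
    have hn := floorA_le n
    simp only [Finset.mem_product, Finset.mem_Icc, Finset.mem_singleton] at h
    rw [TriDB.mem_result, productInstance_R, productInstance_S, productInstance_T]
    simp only [Finset.mem_product, Finset.mem_Icc]
    -- `(b, 1) ∈ S` needs `1 ≤ floorA n`, which comes from `1 ≤ a ≤ floorA n`.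
    omega
  simpa using Finset.card_le_card h

theorem isExtremal_skewBounds :
    IsExtremal skewBounds.family (fun n => floorA n * floorB n) (fun n => n) := by
  refine fun n => ⟨⟨⟨productInstance n, productInstance_mem n, ?_⟩, ?_⟩,
    ⟨⟨productInstance n, productInstance_mem n, ?_⟩, ?_⟩⟩
  · exact le_antisymm (card_result_le (productInstance_mem n)) (le_card_result_productInstance n)
  · rintro _ ⟨A, hA, rfl⟩
    exact card_result_le hA
  · obtain ⟨h1, h2, h3⟩ := card_rel_le (productInstance_mem n)
    refine le_antisymm (max_le h1 (max_le h2 h3)) ?_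
    exact (card_productInstance_T n).ge.trans ((le_max_right _ _).trans (le_max_right _ _))
  · rintro _ ⟨A, hA, rfl⟩
    obtain ⟨h1, h2, h3⟩ := card_rel_le hA
    exact max_le h1 (max_le h2 h3)

/-- `WorstCaseOptimalUpToLog` asserts that some `q` and `M` exist; to refute it they must be
identified with the explicit ones. -/
theorem IsExtremal.eq {K : ℕ → Set TriDB} {q M q' M' : ℕ → ℕ} (h : IsExtremal K q M)
    (h' : IsExtremal K q' M') (n : ℕ) : q n = q' n ∧ M n = M' n :=
  ⟨(h n).1.unique (h' n).1, (h n).2.unique (h' n).2⟩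

/-! ### Leapfrog triejoin on the skewed family -/

theorem projSnd_image_swap (E : Finset (ℕ × ℕ)) : projSnd (E.image Prod.swap) = projFst E := by
  simp [projSnd, projFst, Finset.image_image, Function.comp_def]

theorem projFst_image_swap (E : Finset (ℕ × ℕ)) : projFst (E.image Prod.swap) = projSnd E := by
  simp [projSnd, projFst, Finset.image_image, Function.comp_def]

theorem TriDB.projSnd_atom (A : TriDB) (i j : Fin 3) :
    projSnd (A.atom i j) = projFst (A.atom j i) := by
  have h : projSnd ∅ = projFst ∅ := rfl
  fin_cases i <;> fin_cases j <;> simp [TriDB.atom, projSnd_image_swap, projFst_image_swap, h]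

theorem card_projFst_atom_le {n : ℕ} (hn : 1 ≤ n) {A : TriDB} (hA : A ∈ skewBounds.family n)
    (i j : Fin 3) : (projFst (A.atom i j)).card ≤ n := by
  obtain ⟨h1, h2, h3, h4, h5, h6⟩ := mem_skewBounds_family.1 hA
  have hα := floorA_le n
  have hβ := floorB_le n
  fin_cases i <;> fin_cases j <;> simp only [TriDB.atom, projFst_image_swap, Fin.zero_eta,
    Fin.mk_one, Fin.reduceFinMk] <;> first | omega | simp [projFst]

/-- Of the two atoms containing a variable, `R` bounds `a`, both `R` and `S` bound `b`, and `T`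
bounds `c`. -/
theorem card_projFst_atom_le_or {n : ℕ} {A : TriDB} (hA : A ∈ skewBounds.family n)
    {i j k : Fin 3} (hij : i ≠ j) (hik : i ≠ k) (hjk : j ≠ k) :
    (projFst (A.atom i j)).card ≤ ![floorA n, floorB n, 1] i ∨
      (projFst (A.atom i k)).card ≤ ![floorA n, floorB n, 1] i := by
  obtain ⟨h1, h2, h3, h4, h5, h6⟩ := mem_skewBounds_family.1 hA
  fin_cases i <;> fin_cases j <;> fin_cases k <;>
    simp [TriDB.atom, projFst_image_swap] at hij hik hjk ⊢ <;> omega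

theorem leapfrogTriejoin_time_le {n : ℕ} (hn : 2 ≤ n) {A : TriDB} (hA : A ∈ skewBounds.family n)
    (σ : Equiv.Perm (Fin 3)) :
    ((leapfrogTriejoin σ A).time : ℝ) ≤ 144000 * ((n : ℝ) * Real.logb 2 n) := by
  have hn1 : 1 ≤ n := by omega
  have hne : ∀ {i j : Fin 3}, i ≠ j → σ i ≠ σ j := fun h => σ.injective.ne h
  set N : Fin 3 → ℕ := ![floorA n, floorB n, 1] with hN
  set k := Nat.log 2 n + 1 with hk
  have hlt : ∀ i j, (projFst (A.atom i j)).card < 2 ^ k := fun i j =>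
    (card_projFst_atom_le hn1 hA i j).trans_lt (Nat.lt_pow_succ_log_self one_lt_two n)
  have hlt' : ∀ i j, (projSnd (A.atom i j)).card < 2 ^ k := fun i j => by
    rw [A.projSnd_atom]; exact hlt j i
  have ht : (leapfrogTriejoin σ A).time ≤
      3000 * ((N (σ 0) + 1) * (N (σ 1) + 1) * (N (σ 2) + 1) * (2 * k + 2)) := by
    refine triejoin_time_le (hlt _ _) (hlt' _ _) (hlt _ _) (hlt' _ _) (hlt _ _) (hlt' _ _) ?_ ?_ ?_
    · exact card_projFst_atom_le_or hA (hne (by decide)) (hne (by decide)) (hne (by decide))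
    · rw [A.projSnd_atom]
      exact card_projFst_atom_le_or hA (hne (by decide)) (hne (by decide)) (hne (by decide))
    · rw [A.projSnd_atom, A.projSnd_atom]
      exact card_projFst_atom_le_or hA (hne (by decide)) (hne (by decide)) (hne (by decide))
  -- The product over the variables is invariant under `σ`; the 8 comes from `N i + 1 ≤ 2 * N i` for
  -- all three.
  have hprod : (N (σ 0) + 1) * (N (σ 1) + 1) * (N (σ 2) + 1) ≤ 8 * n := by
    have h := Equiv.prod_comp σ fun i => N i + 1
    rw [Fin.prod_univ_three, Fin.prod_univ_three] at h
    rw [h]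
    have h1 := one_le_floorA hn1
    have h2 := one_le_floorB hn1
    have h3 := floorA_mul_floorB_le n
    calc (floorA n + 1) * (floorB n + 1) * 2 ≤ (2 * floorA n) * (2 * floorB n) * 2 := by
          gcongr <;> omega
      _ ≤ 8 * n := by linarith
  have hlog : ((2 * k + 2 : ℕ) : ℝ) ≤ 6 * Real.logb 2 n := by
    have h1 := Real.natLog_le_logb n 2
    have h2 : (1 : ℝ) ≤ Real.logb 2 n := by
      rw [Real.le_logb_iff_rpow_le one_lt_two (by positivity), Real.rpow_one]
      exact_mod_cast hn
    push_cast [hk] at h1 ⊢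
    linarith
  calc ((leapfrogTriejoin σ A).time : ℝ)
      ≤ 3000 * ((8 * n : ℕ) * (2 * k + 2 : ℕ)) := by
        exact_mod_cast ht.trans (Nat.mul_le_mul_left _ (Nat.mul_le_mul_right _ hprod))
    _ ≤ 3000 * ((8 * n : ℕ) * (6 * Real.logb 2 n)) := by gcongr
    _ = 144000 * ((n : ℝ) * Real.logb 2 n) := by push_cast; ring

theorem leapfrogTriejoin_optimal (σ : Equiv.Perm (Fin 3)) :
    WorstCaseOptimalUpToLog skewBounds.family fun _ A => (leapfrogTriejoin σ A).time := by
  refine ⟨_, _, isExtremal_skewBounds, 576000, 2, fun n hn A hA => ?_⟩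
  have hlog : 0 ≤ Real.logb 2 n :=
    Real.logb_nonneg one_lt_two (by exact_mod_cast (show 1 ≤ n by omega))
  refine (leapfrogTriejoin_time_le hn hA σ).trans ?_
  have := mul_le_mul_of_nonneg_right (le_four_mul_floor (show 1 ≤ n by omega)) hlog
  linarith

/-! ### NPRR on the skewed family -/

theorem TriDB.degR_le (A : TriDB) (b : ℕ) : A.degR b ≤ (projFst A.R).card := by
  refine Finset.card_le_card_of_injOn Prod.fst (fun e he => ?_) fun e he e' he' h => ?_
  · exact Finset.mem_image_of_mem _ (Finset.mem_filter.1 he).1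
  · exact Prod.ext h ((Finset.mem_filter.1 he).2.trans (Finset.mem_filter.1 he').2.symm)

theorem TriDB.degS_le (A : TriDB) (b : ℕ) : A.degS b ≤ (projSnd A.S).card := by
  refine Finset.card_le_card_of_injOn Prod.snd (fun e he => ?_) fun e he e' he' h => ?_
  · exact Finset.mem_image_of_mem _ (Finset.mem_filter.1 he).1
  · exact Prod.ext ((Finset.mem_filter.1 he).2.trans (Finset.mem_filter.1 he').2.symm) h

theorem TriDB.heavy_eq_empty {A : TriDB} {τ : ℝ} (h : ((projFst A.R).card : ℝ) ≤ τ) :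
    A.heavy τ = ∅ := by
  refine Finset.filter_false_of_mem fun b _ => not_lt.2 (le_trans ?_ h)
  exact_mod_cast A.degR_le b

theorem TriDB.light_eq_self {A : TriDB} {τ : ℝ} (h : A.heavy τ = ∅) : A.light τ = A.R := by
  refine Finset.filter_true_of_mem fun e _ => ?_
  rw [h]; exact Finset.notMem_empty _

theorem degR_productInstance {n b : ℕ} (hb : b ∈ Finset.Icc 1 (floorB n)) :
    (productInstance n).degR b = floorA n := by
  have h : (productInstance n).R.filter (fun e => e.2 = b) = Finset.Icc 1 (floorA n) ×ˢ {b} := by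
    ext ⟨x, y⟩
    simp only [productInstance_R, Finset.mem_filter, Finset.mem_product, Finset.mem_singleton]
    constructor
    · rintro ⟨⟨h1, -⟩, rfl⟩; exact ⟨h1, rfl⟩
    · rintro ⟨h1, rfl⟩; exact ⟨⟨h1, hb⟩, rfl⟩
  rw [TriDB.degR, h]; simp

theorem degS_productInstance {n b : ℕ} (hb : b ∈ Finset.Icc 1 (floorB n)) :
    (productInstance n).degS b = floorA n := by
  have h : (productInstance n).S.filter (fun e => e.1 = b) = {b} ×ˢ Finset.Icc 1 (floorA n) := by
    ext ⟨x, y⟩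
    simp only [productInstance_S, Finset.mem_filter, Finset.mem_product, Finset.mem_singleton]
    constructor
    · rintro ⟨⟨-, h1⟩, rfl⟩; exact ⟨rfl, h1⟩
    · rintro ⟨rfl, h1⟩; exact ⟨⟨hb, h1⟩, rfl⟩
  rw [TriDB.degS, h]; simp

/-- Above the degree bound there are no heavy join keys in any instance of the family. -/
theorem nprr_time_le_of_light {n : ℕ} (hn : 1 ≤ n) {τ : ℝ} (hτ : (floorA n : ℝ) ≤ τ) {A : TriDB}
    (hA : A ∈ skewBounds.family n) :
    ((nprr τ A).time : ℝ) ≤ 20 * (n : ℝ) ^ (1.375 : ℝ) := by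
  obtain ⟨h1, h2, h3, h4, h5, h6⟩ := mem_skewBounds_family.1 hA
  obtain ⟨hR, hS, hT⟩ := card_rel_le hA
  have hheavy : A.heavy τ = ∅ :=
    TriDB.heavy_eq_empty (le_trans (by exact_mod_cast h1) hτ)
  have hsum : ∑ e ∈ A.R, A.degS e.2 ≤ n * floorA n := by
    refine (Finset.sum_le_card_nsmul _ _ _ fun e _ => (A.degS_le e.2).trans h4).trans ?_
    rw [smul_eq_mul]
    exact Nat.mul_le_mul_right _ hR
  have hβ := floorB_le n
  -- With no heavy keys the linear terms have coefficients 4 + 2 + 1 + 2, and `G = R` adds 1.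
  have ht : (nprr τ A).time ≤ 10 * n + 4 * (n * floorA n) := by
    rw [nprr_time, TriDB.light_eq_self hheavy, hheavy, Finset.card_empty]
    omega
  obtain ⟨x, hx, h8, h11, -, -, hα, -, -⟩ := exists_eighth_root hn
  have ht' : ((nprr τ A).time : ℝ) ≤ 10 * n + 4 * (n * floorA n) := by exact_mod_cast ht
  have hp : x ^ 8 ≤ x ^ 11 := pow_le_pow_right₀ hx (by norm_num)
  have hp' : x ^ 8 * (floorA n : ℝ) ≤ x ^ 8 * x ^ 3 := by gcongr
  rw [h11]
  rw [h8] at ht'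
  linarith [show x ^ 8 * x ^ 3 = x ^ 11 by ring]

theorem le_nprr_time_productInstance_of_light {n : ℕ} (hn : 1 ≤ n) {τ : ℝ}
    (hτ : (floorA n : ℝ) ≤ τ) :
    1 / 2 * (n : ℝ) ^ (1.375 : ℝ) ≤ (nprr τ (productInstance n)).time := by
  obtain ⟨h1, -⟩ := mem_skewBounds_family.1 (productInstance_mem n)
  have hheavy : (productInstance n).heavy τ = ∅ :=
    TriDB.heavy_eq_empty (le_trans (by exact_mod_cast h1) hτ)
  have hsum : ∑ e ∈ (productInstance n).R, (productInstance n).degS e.2 =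
      floorA n * floorB n * floorA n := by
    rw [← card_productInstance_R, Finset.card_eq_sum_ones, Finset.sum_mul]
    refine Finset.sum_congr rfl fun e he => ?_
    rw [productInstance_R, Finset.mem_product] at he
    rw [degS_productInstance he.2, one_mul]
  have ht : 4 * (floorA n * floorB n * floorA n) ≤ (nprr τ (productInstance n)).time := by
    rw [nprr_time, TriDB.light_eq_self hheavy, hsum]
    omega
  have ht' : 4 * ((floorA n : ℝ) * floorB n * floorA n) ≤ (nprr τ (productInstance n)).time := by
    exact_mod_cast ht
  obtain ⟨x, hx, -, h11, -, hα, -, hβ, -⟩ := exists_eighth_root hn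
  rw [h11]
  have hx0 : 0 ≤ x := zero_le_one.trans hx
  -- Three roundings cost a factor 8, and the coefficient 4 of the join leaves 1/2.
  have hle : x ^ 3 / 2 * (x ^ 5 / 2) * (x ^ 3 / 2) ≤ (floorA n : ℝ) * floorB n * floorA n :=
    mul_le_mul (mul_le_mul hα hβ (by positivity) (Nat.cast_nonneg _)) hα (by positivity)
      (by positivity)
  linarith [show x ^ 3 / 2 * (x ^ 5 / 2) * (x ^ 3 / 2) = x ^ 11 / 8 by ring]

/-- All keys have degree `floorA n`, so they become heavy together. -/
theorem heavy_productInstance {n : ℕ} (hn : 1 ≤ n) {τ : ℝ} (hτ : τ < floorA n) :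
    (productInstance n).heavy τ = Finset.Icc 1 (floorB n) := by
  have h1 := one_le_floorA hn
  ext b
  rw [TriDB.heavy, Finset.mem_filter]
  constructor
  · exact fun h => projSnd_product_subset _ _ h.1
  · intro h
    rw [degR_productInstance h]
    refine ⟨mem_projSnd (x := 1) ?_, hτ⟩
    rw [productInstance_R]
    exact Finset.mem_product.2 ⟨Finset.mem_Icc.2 ⟨le_rfl, h1⟩, h⟩

theorem nprr_time_productInstance_of_heavy {n : ℕ} (hn : 1 ≤ n) {τ : ℝ} (hτ : τ < floorA n) :
    1 / 2 * (n : ℝ) ^ (1.625 : ℝ) ≤ (nprr τ (productInstance n)).time ∧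
      ((nprr τ (productInstance n)).time : ℝ) ≤ 20 * (n : ℝ) ^ (1.625 : ℝ) := by
  have hheavy := heavy_productInstance hn hτ
  have hlight : (productInstance n).light τ = ∅ := by
    refine Finset.filter_false_of_mem fun e he => not_not.2 ?_
    rw [productInstance_R, Finset.mem_product] at he
    rw [hheavy]; exact he.2
  obtain ⟨hR, hS, -⟩ := card_rel_le (productInstance_mem n)
  obtain ⟨-, h2, -⟩ := mem_skewBounds_family.1 (productInstance_mem n)
  have hβn := floorB_le n
  have ht := nprr_time τ (productInstance n)
  rw [hheavy, hlight, card_productInstance_T, Nat.card_Icc, Finset.sum_empty, Finset.card_empty,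
    Nat.add_sub_cancel] at ht
  obtain ⟨x, hx, h8, -, h13, -, -, hβ, hβ'⟩ := exists_eighth_root hn
  have hlo : 5 * ((floorB n : ℝ) * n) ≤ (nprr τ (productInstance n)).time := by
    exact_mod_cast (show 5 * (floorB n * n) ≤ (nprr τ (productInstance n)).time by omega)
  -- The linear terms have coefficients 4 + 2 + 1 + 2 + 2 = 11.
  have hhi : ((nprr τ (productInstance n)).time : ℝ) ≤ 11 * n + 5 * ((floorB n : ℝ) * n) := by
    exact_mod_cast
      (show (nprr τ (productInstance n)).time ≤ 11 * n + 5 * (floorB n * n) by omega)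
  rw [h13]
  rw [h8] at hlo hhi
  have hp : x ^ 8 ≤ x ^ 13 := pow_le_pow_right₀ hx (by norm_num)
  have hp1 : x ^ 5 / 2 * x ^ 8 ≤ floorB n * x ^ 8 := by gcongr
  have hp2 : (floorB n : ℝ) * x ^ 8 ≤ x ^ 5 * x ^ 8 := by gcongr
  have h0 : 0 ≤ x ^ 13 := by positivity
  rw [show x ^ 5 / 2 * x ^ 8 = x ^ 13 / 2 by ring] at hp1
  rw [show x ^ 5 * x ^ 8 = x ^ 13 by ring] at hp2
  constructor <;> linarith

theorem le_nprr_time_productInstance {n : ℕ} (hn : 1 ≤ n) (τ : ℝ) :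
    1 / 2 * (n : ℝ) ^ (1.375 : ℝ) ≤ (nprr τ (productInstance n)).time := by
  rcases le_or_gt (floorA n : ℝ) τ with hτ | hτ
  · exact le_nprr_time_productInstance_of_light hn hτ
  · refine le_trans ?_ (nprr_time_productInstance_of_heavy hn hτ).1
    have h1 : (1 : ℝ) ≤ n := by exact_mod_cast hn
    gcongr
    norm_num

theorem nprr_not_optimal (τ : ℕ → TriDB → ℝ) :
    ¬ WorstCaseOptimalUpToLog skewBounds.family fun n A => (nprr (τ n A) A).time := by
  rintro ⟨q, M, hext, C, n₀, h⟩
  have hl2 : 0 < Real.log 2 := Real.log_pos one_lt_two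
  have hC : 0 < 4 * (|C| + 1) := by positivity
  -- The factor in log n = o(n^{0.375}) is chosen so that the supposed bound is at most n^{1.375}/4,
  -- below the lower bound n^{1.375}/2. Using `|C| + 1` covers nonpositive `C`.
  have hev := ((isLittleO_log_rpow_atTop (show (0 : ℝ) < 0.375 by norm_num)).def
    (div_pos hl2 hC)).natCast_atTop
  obtain ⟨n, hn, hn₀⟩ := (hev.and (Filter.eventually_ge_atTop (max n₀ 1))).exists
  have hn1 : 1 ≤ n := (le_max_right _ _).trans hn₀
  have hr1 : (1 : ℝ) ≤ n := by exact_mod_cast hn1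
  have hlog : 0 ≤ Real.log n := Real.log_nonneg hr1
  have hpos : 0 < (n : ℝ) ^ (0.375 : ℝ) := by positivity
  rw [Real.norm_of_nonneg hlog, Real.norm_of_nonneg hpos.le] at hn
  have h1 := (le_nprr_time_productInstance hn1 (τ n (productInstance n))).trans
    (h n ((le_max_left _ _).trans hn₀) _ (productInstance_mem n))
  obtain ⟨hq, hM⟩ := hext.eq isExtremal_skewBounds n
  have hlogb : Real.logb 2 n ≤ (n : ℝ) ^ (0.375 : ℝ) / (4 * (|C| + 1)) := by
    rw [Real.logb, div_le_iff₀ hl2]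
    calc Real.log n ≤ _ := hn
      _ = _ := by ring
  have hlogb0 : 0 ≤ Real.logb 2 n := div_nonneg hlog hl2.le
  have hqn : (q n : ℝ) ≤ n := by rw [hq]; exact_mod_cast floorA_mul_floorB_le n
  have h2 : C * ((q n : ℝ) * Real.logb 2 (M n)) ≤ (n : ℝ) * (n : ℝ) ^ (0.375 : ℝ) / 4 := by
    rw [hM]
    calc C * ((q n : ℝ) * Real.logb 2 n)
        ≤ (|C| + 1) * ((n : ℝ) * ((n : ℝ) ^ (0.375 : ℝ) / (4 * (|C| + 1)))) := by
          have : C ≤ |C| + 1 := (le_abs_self C).trans (by linarith)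
          gcongr
      _ = _ := by field_simp
  have h3 : (n : ℝ) ^ (1.375 : ℝ) = n * (n : ℝ) ^ (0.375 : ℝ) := by
    rw [show (1.375 : ℝ) = 1 + 0.375 by norm_num, Real.rpow_add (by linarith), Real.rpow_one]
  rw [h3] at h1
  have h4 : 0 < (n : ℝ) * (n : ℝ) ^ (0.375 : ℝ) := by positivity
  linarith

/-! ### The main theorem -/

theorem mainTheorem4 :
    -- both algorithms compute the query result
    (∀ (σ : Equiv.Perm (Fin 3)) (A : TriDB), (leapfrogTriejoin σ A).val.toFinset = A.result) ∧
    (∀ (τ : ℝ) (A : TriDB), 0 ≤ τ → (nprr τ A).val.toFinset = A.result) ∧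
    -- leapfrog triejoin runs in O(n log n) over the family
    (∃ C : ℝ, ∀ n : ℕ, 2 ≤ n → ∀ A ∈ skewBounds.family n, ∀ σ : Equiv.Perm (Fin 3),
      ((leapfrogTriejoin σ A).time : ℝ) ≤ C * ((n : ℝ) * Real.logb 2 n)) ∧
    -- the product instances belong to the family
    (∀ n : ℕ, productInstance n ∈ skewBounds.family n) ∧
    -- the running time of NPRR, with constants that do not depend on n and τ
    (∃ c C : ℝ, 0 < c ∧ ∀ n : ℕ, 1 ≤ n → ∀ τ : ℝ, 0 ≤ τ →
      ((⌊(n : ℝ) ^ (3 / 8 : ℝ)⌋₊ : ℝ) ≤ τ →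
        c * (n : ℝ) ^ (1.375 : ℝ) ≤ (nprr τ (productInstance n)).time ∧
        ((nprr τ (productInstance n)).time : ℝ) ≤ C * (n : ℝ) ^ (1.375 : ℝ)) ∧
      (τ < (⌊(n : ℝ) ^ (3 / 8 : ℝ)⌋₊ : ℝ) →
        c * (n : ℝ) ^ (1.625 : ℝ) ≤ (nprr τ (productInstance n)).time ∧
        ((nprr τ (productInstance n)).time : ℝ) ≤ C * (n : ℝ) ^ (1.625 : ℝ)) ∧
      c * (n : ℝ) ^ (1.375 : ℝ) ≤ (nprr τ (productInstance n)).time ∧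
      ((⌊(n : ℝ) ^ (3 / 8 : ℝ)⌋₊ : ℝ) ≤ τ → ∀ A ∈ skewBounds.family n,
        ((nprr τ A).time : ℝ) ≤ C * (n : ℝ) ^ (1.375 : ℝ))) ∧
    -- leapfrog triejoin is worst-case optimal (up to a log factor) for the family, and NPRR is not,
    -- for any choice of its threshold, even one that depends on the instance
    (∀ σ : Equiv.Perm (Fin 3),
      WorstCaseOptimalUpToLog skewBounds.family fun _ A => (leapfrogTriejoin σ A).time) ∧
    (∀ τ : ℕ → TriDB → ℝ, (∀ n A, 0 ≤ τ n A) →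
      ¬ WorstCaseOptimalUpToLog skewBounds.family fun n A => (nprr (τ n A) A).time) := by
  refine ⟨leapfrogTriejoin_toFinset, fun τ A _ => nprr_toFinset τ A,
    ⟨144000, fun n hn A hA σ => leapfrogTriejoin_time_le hn hA σ⟩, productInstance_mem,
    ⟨1 / 2, 20, by norm_num, fun n hn τ _ => ⟨fun hτ => ?_, fun hτ => ?_, ?_, fun hτ A hA => ?_⟩⟩,
    leapfrogTriejoin_optimal, fun τ _ => nprr_not_optimal τ⟩
  · exact ⟨le_nprr_time_productInstance hn τ,
      nprr_time_le_of_light hn hτ (productInstance_mem n)⟩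
  · exact nprr_time_productInstance_of_heavy hn hτ
  · exact le_nprr_time_productInstance hn τ
  · exact nprr_time_le_of_light hn hτ hA
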